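/- **Setting.** Let $M$ be a smooth finite-dimensional manifold with tangent bundle $\pi:TM\to M$, and let $(M,L)$ be a Finsler manifold: $L:TM\to\mathbb R$ is continuous, smooth and positive on the set of nonzero tangent vectors, positively homogeneous of degree $1$ on the fibres, and the Finsler metric $g$, i.e. the fibrewise Hessian of $\tfrac12L^2$, is positive definite at every nonzero tangent vector. All objects below live over the slit tangent bundle $\{u\in TM: u\neq 0\}$ and are smooth there. A *$\pi$-vector field* is a section of the pullback bundle $\pi^{-1}(TM)$; $\overline\eta(u)=(u,u)$ is the fundamental one; $\rho=d\pi:T(TM)\to\pi^{-1}(TM)$, and $\gamma:\pi^{-1}(TM)\to T(TM)$ is the vertical lift. For a linear connection $D$ on $\pi^{-1}(TM)$ put $K(X)=D_X\overline\eta$. $D$ is *regular* if $T_u(TM)=\ker d\pi\oplus\ker K$ for every nonzero $u$; then $\beta:=(\rho|_{\ker K})^{-1}$ is its horizontal map. Let $\mathbf T(X,Y)=D_X\rho Y-D_Y\rho X-\rho[X,Y]$ and $$\mathbf K(X,Y)\overline Z=-D_XD_Y\overline Z+D_YD_X\overline Z+D_{[X,Y]}\overline Z$$ be its torsion and curvature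 (note the sign convention), and put $Q(\overline X,\overline Y)=\mathbf T(\beta\overline X,\beta\overline Y)$, $T(\overline X,\overline Y)=\mathbf T(\gamma\overline X,\beta\overline Y)$, $R(\overline X,\overline Y)\overline Z=\mathbf K(\beta\overline X,\beta\overline Y)\overline Z$, $P(\overline X,\overline Y)\overline Z=\mathbf K(\beta\overline X,\gamma\overline Y)\overline Z$, $\widehat R(\overline X,\overline Y)=R(\overline X,\overline Y)\overline\eta$, $\widehat P(\overline X,\overline Y)=P(\overline X,\overline Y)\overline\eta$. The *Cartan connection* $\nabla$ of $(M,L)$ is the regular connection on $\pi^{-1}(TM)$ with $\nabla g=0$, $Q=0$ and $g(T(\overline X,\overline Y),\overline Z)=g(T(\overline X,\overline Z),\overline Y)$; from now on $K,\beta,T,R,P,\widehat R,\widehat P$ are those of $\nabla$. A $\pi$-vector field $\overline\zeta$ is *concircular*, with associated smooth functions $\sigma,\psi$ on $M$ (regarded as functions on $TM$ depending on the base point only), $\psi$ nowhere zero, if for all $\pi$-vector fields $\overline X$ $$\nabla_{\beta\overline X}\overline\zeta=\alpha(\overline X)\overline\zeta+\psi\,\overline X,\qquad \nabla_{\gamma\overline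 X}\overline\zeta=0,\qquad\text{where }\alpha(\overline X)=d\sigma(\beta\overline X).$$ Put $\mu(\overline X)=d\psi(\beta\overline X)$ and $\omega(\overline X)=g(\overline\zeta,\overline X)$. **Proposition.** Let $\overline\zeta$ be a concircular $\pi$-vector field on $(M,L)$. For all $\pi$-vector fields $\overline X,\overline Y$: (a) $T(\overline X,\overline\zeta)=T(\overline\zeta,\overline X)=0$; (b) $\widehat P(\overline X,\overline\zeta)=\widehat P(\overline\zeta,\overline X)=0$; (c) $\widehat R(\overline X,\overline\zeta)=K[\beta\overline X,\beta\overline\zeta]$; (d) $P(\overline X,\overline\zeta)\overline Y=P(\overline\zeta,\overline X)\overline Y=0$; (e) $(\mu(\overline Y)-\psi\,\alpha(\overline Y))\,\omega(\overline X)-(\mu(\overline X)-\psi\,\alpha(\overline X))\,\omega(\overline Y)=0$; (f) $\mu(T(\overline X,\overline Y))=\psi\,\alpha(T(\overline X,\overline Y))$. -/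

import Mathlib

open Bundle
open scoped Manifold ContDiff Bundle Topology

noncomputable section

namespace PiFinsler

/-! ## The pullback of the tangent bundle over itself -/

section Pullback

variable (E : Type*) [NormedAddCommGroup E] [NormedSpace ℝ E]
  (M : Type*) [TopologicalSpace M] [ChartedSpace E M] [IsManifold 𝓘(ℝ, E) ∞ M]

/-- The total space `TM` of the tangent bundle of `M`. -/
abbrev TM : Type _ := TangentBundle 𝓘(ℝ, E) M

/-- The projection `π : TM → M`, as a smooth map. -/
def proj : C^∞⟮𝓘(ℝ, E).tangent, TM E M; 𝓘(ℝ, E), M⟯ :=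
  ⟨TotalSpace.proj, contMDiff_proj _⟩

/-- The pullback bundle `π⁻¹(TM)` over `TM`; its fibre over `u ∈ T_x M` is `T_x M`. -/
abbrev PiBundle : TM E M → Type _ :=
  (proj E M : TM E M → M) *ᵖ (TangentSpace 𝓘(ℝ, E) : M → Type _)

instance instAddCommGroupPiBundle (u : TM E M) : AddCommGroup (PiBundle E M u) :=
  inferInstanceAs (AddCommGroup (TangentSpace 𝓘(ℝ, E) u.proj))

instance instIsTopologicalAddGroupPiBundle (u : TM E M) :
    IsTopologicalAddGroup (PiBundle E M u) :=
  inferInstanceAs (IsTopologicalAddGroup (TangentSpace 𝓘(ℝ, E) u.proj))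

instance instContinuousSMulPiBundle (u : TM E M) : ContinuousSMul ℝ (PiBundle E M u) :=
  inferInstanceAs (ContinuousSMul ℝ (TangentSpace 𝓘(ℝ, E) u.proj))

/-- The slit tangent bundle: the open set of nonzero tangent vectors. Every object of Finsler
geometry below is considered on this set only; values elsewhere are irrelevant. -/
def slit : Set (TM E M) := {u | u.2 ≠ 0}

/-- (Not necessarily smooth) sections of `π⁻¹(TM)`. -/
abbrev PiField : Type _ := ∀ u : TM E M, PiBundle E M u

/-- (Not necessarily smooth) vector fields on the manifold `TM`. -/
abbrev TField : Type _ := ∀ u : TM E M, TangentSpace 𝓘(ℝ, E).tangent u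

/-- The type of the operators `D : Z̄ ↦ (u ↦ (X ↦ D_X Z̄ (u)))`, with `X ∈ T_u(TM)`. -/
abbrev ConnOp : Type _ :=
  PiField E M → ∀ u : TM E M, TangentSpace 𝓘(ℝ, E).tangent u →L[ℝ] PiBundle E M u

end Pullback

variable {E : Type*} [NormedAddCommGroup E] [NormedSpace ℝ E]
  {M : Type*} [TopologicalSpace M] [ChartedSpace E M] [IsManifold 𝓘(ℝ, E) ∞ M]

/-- `X` is a `π`-vector field: a section of `π⁻¹(TM)`, smooth on the slit tangent bundle. -/
def IsPiVectorField (X : PiField E M) : Prop :=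
  ContMDiffOn 𝓘(ℝ, E).tangent (𝓘(ℝ, E).tangent.prod 𝓘(ℝ, E)) ∞
    (fun u ↦ (⟨u, X u⟩ : TotalSpace E (PiBundle E M))) (slit E M)

/-- The fundamental `π`-vector field `η(u) = (u, u)`. -/
def eta : PiField E M := fun u ↦ u.2

/-- The bundle morphism `ρ = dπ : T(TM) → π⁻¹(TM)`. -/
def rho (u : TM E M) : TangentSpace 𝓘(ℝ, E).tangent u →L[ℝ] PiBundle E M u :=
  mfderiv 𝓘(ℝ, E).tangent 𝓘(ℝ, E) (proj E M) u

/-- The vertical lift `γ : π⁻¹(TM) → T(TM)`: the derivative at `u` of the inclusion of the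
fibre `T_x M` in `TM`. -/
def gamma (u : TM E M) : PiBundle E M u →L[ℝ] TangentSpace 𝓘(ℝ, E).tangent u :=
  mfderiv 𝓘(ℝ, E) 𝓘(ℝ, E).tangent (fun w : E ↦ (⟨u.1, w⟩ : TM E M)) (u.2 : E)

/-! ## Linear connections on the pullback bundle -/

/-- `D` is a (smooth, linear) connection on `π⁻¹(TM)`, over the slit tangent bundle. -/
structure IsLinearConnection (D : ConnOp E M) : Prop where
  isCovariantDerivativeOn : IsCovariantDerivativeOn E D (slit E M)
  contMDiff : ContMDiffCovariantDerivativeOn E ∞ D (slit E M)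

/-- The connection map `K : X ↦ D_X η`. -/
def connMap (D : ConnOp E M) (u : TM E M) :
    TangentSpace 𝓘(ℝ, E).tangent u →L[ℝ] PiBundle E M u :=
  D eta u

/-- `D` is regular: `T_u(TM)` is the direct sum of the vertical space `ker dπ` and of the
horizontal space `ker K`. -/
def IsRegular (D : ConnOp E M) : Prop :=
  ∀ u ∈ slit E M, IsCompl (rho u).ker (connMap D u).ker

/-- The horizontal map `β`: the inverse of the restriction of `ρ` to the horizontal space (and
`0` where that restriction is not invertible, which does not happen for a regular connection). -/
def beta (D : ConnOp E M) (u : TM E M) :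
    PiBundle E M u →L[ℝ] TangentSpace 𝓘(ℝ, E).tangent u :=
  (connMap D u).ker.subtypeL ∘L (rho u ∘L (connMap D u).ker.subtypeL).inverse

/-- The vector field `γX̄` on `TM`. -/
def vert (X : PiField E M) : TField E M := fun u ↦ gamma u (X u)

/-- The vector field `βX̄` on `TM`. -/
def horiz (D : ConnOp E M) (X : PiField E M) : TField E M := fun u ↦ beta D u (X u)

/-- The classical torsion `D_X ρY - D_Y ρX - ρ[X, Y]`. -/
def torsion (D : ConnOp E M) (X Y : TField E M) : PiField E M := fun u ↦
  D (fun v ↦ rho v (Y v)) u (X u) - D (fun v ↦ rho v (X v)) u (Y u)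
    - rho u (VectorField.mlieBracket 𝓘(ℝ, E).tangent X Y u)

/-- The classical curvature, with the sign convention
`𝐊(X, Y)Z̄ = -D_X D_Y Z̄ + D_Y D_X Z̄ + D_[X, Y] Z̄`. -/
def curvature (D : ConnOp E M) (X Y : TField E M) (Z : PiField E M) : PiField E M := fun u ↦
  - D (fun v ↦ D Z v (Y v)) u (X u) + D (fun v ↦ D Z v (X v)) u (Y u)
    + D Z u (VectorField.mlieBracket 𝓘(ℝ, E).tangent X Y u)

/-- The (h)h-torsion `Q(X̄, Ȳ) = 𝐓(βX̄, βȲ)`. -/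
def torsionQ (D : ConnOp E M) (X Y : PiField E M) : PiField E M :=
  torsion D (horiz D X) (horiz D Y)

/-- The (h)hv-torsion `T(X̄, Ȳ) = 𝐓(γX̄, βȲ)`. -/
def torsionT (D : ConnOp E M) (X Y : PiField E M) : PiField E M :=
  torsion D (vert X) (horiz D Y)

/-- The h-curvature `R(X̄, Ȳ)Z̄ = 𝐊(βX̄, βȲ)Z̄`. -/
def curvR (D : ConnOp E M) (X Y Z : PiField E M) : PiField E M :=
  curvature D (horiz D X) (horiz D Y) Z

/-- The hv-curvature `P(X̄, Ȳ)Z̄ = 𝐊(βX̄, γȲ)Z̄`. -/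
def curvP (D : ConnOp E M) (X Y Z : PiField E M) : PiField E M :=
  curvature D (horiz D X) (vert Y) Z

/-- The (v)h-torsion `R̂(X̄, Ȳ) = R(X̄, Ȳ)η`. -/
def hatR (D : ConnOp E M) (X Y : PiField E M) : PiField E M := curvR D X Y eta

/-- The (v)hv-torsion `P̂(X̄, Ȳ) = P(X̄, Ȳ)η`. -/
def hatP (D : ConnOp E M) (X Y : PiField E M) : PiField E M := curvP D X Y eta

/-! ## Finsler manifolds and the Cartan connection -/

/-- The Finsler metric `g` defined by `L`: at `u ∈ T_x M`, the Hessian at `u` of the restriction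
of `L² / 2` to the vector space `T_x M`. -/
def metric (L : TM E M → ℝ) (u : TM E M) : PiBundle E M u →L[ℝ] PiBundle E M u →L[ℝ] ℝ :=
  fderiv ℝ (fderiv ℝ (fun w : E ↦ L ⟨u.1, w⟩ ^ 2 / 2)) (u.2 : E)

/-- `L` is a Finsler structure on `M`. -/
structure IsFinsler (L : TM E M → ℝ) : Prop where
  continuous : Continuous L
  contMDiffOn : ContMDiffOn 𝓘(ℝ, E).tangent 𝓘(ℝ, ℝ) ∞ L (slit E M)
  pos : ∀ u ∈ slit E M, 0 < L u
  homogeneous : ∀ (x : M) (y : TangentSpace 𝓘(ℝ, E) x) (t : ℝ), 0 < t →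
    L ⟨x, t • y⟩ = t * L ⟨x, y⟩
  posDef : ∀ u ∈ slit E M, ∀ v : PiBundle E M u, v ≠ 0 → 0 < metric L u v v

/-- `D` is the Cartan connection of `(M, L)`: the regular connection on `π⁻¹(TM)` that is metric,
has no (h)h-torsion, and whose (h)hv-torsion `T` satisfies `g(T(X̄, Ȳ), Z̄) = g(T(X̄, Z̄), Ȳ)`. -/
structure IsCartanConnection (L : TM E M → ℝ) (D : ConnOp E M) : Prop where
  isLinearConnection : IsLinearConnection D
  isRegular : IsRegular D
  metric_compat : ∀ Y Z : PiField E M, IsPiVectorField Y → IsPiVectorField Z →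
    ∀ u ∈ slit E M, ∀ X : TangentSpace 𝓘(ℝ, E).tangent u,
      mvfderiv 𝓘(ℝ, E).tangent (fun v ↦ metric L v (Y v) (Z v)) u X
        = metric L u (D Y u X) (Z u) + metric L u (Y u) (D Z u X)
  torsionQ_eq_zero : ∀ X Y : PiField E M, IsPiVectorField X → IsPiVectorField Y →
    ∀ u ∈ slit E M, torsionQ D X Y u = 0
  torsionT_symm : ∀ X Y Z : PiField E M, IsPiVectorField X → IsPiVectorField Y →
    IsPiVectorField Z → ∀ u ∈ slit E M,
      metric L u (torsionT D X Y u) (Z u) = metric L u (torsionT D X Z u) (Y u)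

/-! ## Concircular `π`-vector fields -/

/-- The `π`-form `X̄ ↦ df(βX̄)` of a function `f` on `M`, regarded as the function `f ∘ π` on `TM`. -/
def hDiff (D : ConnOp E M) (f : M → ℝ) (u : TM E M) : PiBundle E M u →L[ℝ] ℝ :=
  mvfderiv 𝓘(ℝ, E).tangent (fun v : TM E M ↦ f (proj E M v)) u ∘L beta D u

/-- `ζ` is a concircular `π`-vector field with respect to `D`, with associated functions `σ` and
`ψ`, and `α(X̄) = dσ(βX̄)`:
`D_{βX̄} ζ = α(X̄)ζ + ψX̄` and `D_{γX̄} ζ = 0`. -/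
structure IsConcircular (D : ConnOp E M) (σ ψ : M → ℝ) (ζ : PiField E M) : Prop where
  isPiVectorField : IsPiVectorField ζ
  smooth_sigma : ContMDiff 𝓘(ℝ, E) 𝓘(ℝ, ℝ) ∞ σ
  smooth_psi : ContMDiff 𝓘(ℝ, E) 𝓘(ℝ, ℝ) ∞ ψ
  psi_ne_zero : ∀ x, ψ x ≠ 0
  horizontal : ∀ X : PiField E M, IsPiVectorField X → ∀ u ∈ slit E M,
    D ζ u (horiz D X u) = hDiff D σ u (X u) • ζ u + ψ (proj E M u) • X u
  vertical : ∀ X : PiField E M, IsPiVectorField X → ∀ u ∈ slit E M,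
    D ζ u (vert X u) = 0

end PiFinsler

end

/-! Write `θ = dψ - ψ dσ` for the form pulled back to `TM` (`concircularForm`) and `C` for the third
fibre derivative of `L² / 2` (`cubic`). Three facts about the Cartan connection carry the proof.
First, `2 g(T(X, Y), Z) = C(X, Y, Z)` (`metric_torsionT`), where `C` is totally symmetric and, by
homogeneity, vanishes on `η`. Hence `D_{γX} η = X`, and every vector field on `TM` splits as `V =
βρV + γKV`. Second, the curvature is skew for `g` (`metric_curvature`). Third, the first Bianchi
identity and this skewness express `P` through `C`, its horizontal covariant derivative and `P̂`
(`two_mul_metric_curvP`), in the way the Christoffel symbols come from the derivatives of a metric.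

For a concircular `ζ` the splitting gives `D_V ζ = dσ(V) ζ + ψ ρV` for every `V`. Since `d(dσ) = 0`,
it follows that `𝐊(V, W)ζ = θ(W) ρV - θ(V) ρW - ψ 𝐓(V, W)` (`IsConcircular.curvature_eq`). By
skewness the product of this with `ζ` is zero. For `V = γX`, `W = βY` both `θ(V)` and `ρV` vanish,
so `ψ g(T(X, Y), ζ) = 0`: `ζ` annihilates `C`, which is (a). For two horizontal fields `Q = 0`, and
what remains is (e).

Differentiating `C(X, Y, ζ) = 0` along `βA` gives `(D_{βA} C)(X, Y, ζ) = -ψ C(X, Y, A)`, symmetric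
in `A, X, Y`. In the formula for `P` with `ζ` in one of the first two slots, the two derivative
terms therefore cancel and the `P̂` terms vanish: this is (d). Part (b) follows likewise from `2
g(P̂(X, Y), W) = (D_{βη} C)(Y, X, W)`, and (c) only uses `D_{βX} η = 0`.

For (f), the vector `T = T(X, Y)` is orthogonal to `ζ` and to `η`. Where `ζ ≠ 0`, (e) for the pair
`ζ, T` gives `θ(βT) g(ζ, ζ) = 0`. At a zero of `ζ` the identity (e) is empty, but its derivative
along `βη`, for the pair `η, T`, gives `θ(βT) ψ g(η, η) = 0`. -/

namespace PiFinsler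

/-! ### Lie brackets as commutators of derivations. -/

section Bracket

variable {F : Type*} [NormedAddCommGroup F] [NormedSpace ℝ F]
  {E : Type*} [NormedAddCommGroup E] [NormedSpace ℝ E]
  {H : Type*} [TopologicalSpace H] {I : ModelWithCorners ℝ E H}
  {N : Type*} [TopologicalSpace N] [ChartedSpace H N]

/-- The Lie bracket of two vector fields on a vector space acts on functions as the commutator
of the two derivations. -/
theorem fderiv_lieBracket {f : E → F} {V W : E → E} {y : E} (hf : ContDiffAt ℝ 2 f y)
    (hV : DifferentiableAt ℝ V y) (hW : DifferentiableAt ℝ W y) :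
    fderiv ℝ f y (VectorField.lieBracket ℝ V W y) =
      fderiv ℝ (fun z ↦ fderiv ℝ f z (W z)) y (V y) -
        fderiv ℝ (fun z ↦ fderiv ℝ f z (V z)) y (W y) := by
  have hd : DifferentiableAt ℝ (fderiv ℝ f) y :=
    (hf.fderiv_right (m := 1) (by norm_num)).differentiableAt (by norm_num)
  have hs := (hf.isSymmSndFDerivAt (by simp)).eq (V y) (W y)
  rw [fderiv_clm_apply hd hW, fderiv_clm_apply hd hV]
  simp [VectorField.lieBracket, hs]

theorem mvfderiv_eq_fderiv_extChartAt [I.Boundaryless] {f : N → F} {x : N}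
    (hf : MDifferentiableAt I 𝓘(ℝ, F) f x) (v : TangentSpace I x) :
    mvfderiv I f x v = fderiv ℝ (f ∘ (extChartAt I x).symm) (extChartAt I x x) v := by
  rw [hf.mvfderiv, I.range_eq_univ, fderivWithin_univ]
  rfl

variable [IsManifold I 2 N]

theorem mdifferentiableAt_of_comp_extChartAt_symm {f : N → F} {x : N}
    (h : DifferentiableAt ℝ (f ∘ (extChartAt I x).symm) (extChartAt I x x)) :
    MDifferentiableAt I 𝓘(ℝ, F) f x := by
  have h1 := (mdifferentiableAt_iff_differentiableAt.2 h).comp x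
    (mdifferentiableAt_extChartAt (I := I) (mem_chart_source H x))
  refine h1.congr_of_eventuallyEq ?_
  filter_upwards [extChartAt_source_mem_nhds (I := I) x] with y hy
  simp only [Function.comp_apply, (extChartAt I x).left_inv hy]

variable [I.Boundaryless]

/-- The pullback applies the inverse of the derivative of the inverse chart, and the chain rule
cancels it. -/
theorem fderiv_comp_extChartAt_symm_mpullback {f : N → F} {x : N} (U : ∀ x : N, TangentSpace I x)
    {y : E} (hy : y ∈ (extChartAt I x).target)
    (hf : MDifferentiableAt I 𝓘(ℝ, F) f ((extChartAt I x).symm y)) :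
    fderiv ℝ (f ∘ (extChartAt I x).symm) y
        (VectorField.mpullbackWithin 𝓘(ℝ, E) I (extChartAt I x).symm U (Set.range I) y) =
      mvfderiv I f ((extChartAt I x).symm y) (U ((extChartAt I x).symm y)) := by
  have hs : MDifferentiableAt 𝓘(ℝ, E) I (extChartAt I x).symm y := by
    have := mdifferentiableWithinAt_extChartAt_symm (I := I) hy
    rwa [I.range_eq_univ, mdifferentiableWithinAt_univ] at this
  have hc := mfderiv_comp y hf hs
  rw [mfderiv_eq_fderiv] at hc
  have h1 : fderiv ℝ (f ∘ (extChartAt I x).symm) y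
        (VectorField.mpullbackWithin 𝓘(ℝ, E) I (extChartAt I x).symm U (Set.range I) y) =
      mfderiv I 𝓘(ℝ, F) f ((extChartAt I x).symm y) (mfderiv 𝓘(ℝ, E) I (extChartAt I x).symm y
        (VectorField.mpullbackWithin 𝓘(ℝ, E) I (extChartAt I x).symm U (Set.range I) y)) := by
    exact congrArg (fun A ↦ A
      (VectorField.mpullbackWithin 𝓘(ℝ, E) I (extChartAt I x).symm U (Set.range I) y)) hc
  have hinv := isInvertible_mfderivWithin_extChartAt_symm (I := I) hy
  have he : mfderivWithin 𝓘(ℝ, E) I (extChartAt I x).symm (Set.range I) y =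
      mfderiv 𝓘(ℝ, E) I (extChartAt I x).symm y := by
    rw [I.range_eq_univ, mfderivWithin_univ]
  have h2 := hinv.self_apply_inverse (U ((extChartAt I x).symm y))
  rw [he] at h2
  rw [h1, VectorField.mpullbackWithin_apply, he]
  exact congrArg (mfderiv I 𝓘(ℝ, F) f ((extChartAt I x).symm y)) h2

variable [CompleteSpace E]

/-- The Lie bracket of two vector fields acts on functions as the commutator of the two
derivations. -/
theorem mvfderiv_mlieBracket {f : N → F} {V W : ∀ x : N, TangentSpace I x} {x : N}
    (hf : ContMDiffAt I 𝓘(ℝ, F) 2 f x)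
    (hV : MDifferentiableAt I I.tangent (fun x ↦ (⟨x, V x⟩ : TangentBundle I N)) x)
    (hW : MDifferentiableAt I I.tangent (fun x ↦ (⟨x, W x⟩ : TangentBundle I N)) x) :
    mvfderiv I f x (VectorField.mlieBracket I V W x) =
      mvfderiv I (fun y ↦ mvfderiv I f y (W y)) x (V x) -
        mvfderiv I (fun y ↦ mvfderiv I f y (V y)) x (W x) := by
  set φ := extChartAt I x
  set V' := VectorField.mpullbackWithin 𝓘(ℝ, E) I φ.symm V (Set.range I) with hV'
  set W' := VectorField.mpullbackWithin 𝓘(ℝ, E) I φ.symm W (Set.range I) with hW'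
  have hu : (extChartAt I x).symm ⁻¹' Set.univ ∩ Set.range I = Set.univ := by
    rw [I.range_eq_univ, Set.preimage_univ, Set.univ_inter]
  have dV : DifferentiableAt ℝ V' (φ x) := by
    have := hV.mdifferentiableWithinAt (s := Set.univ)
      |>.differentiableWithinAt_mpullbackWithin_vectorField
    rw [hu] at this
    exact differentiableWithinAt_univ.1 this
  have dW : DifferentiableAt ℝ W' (φ x) := by
    have := hW.mdifferentiableWithinAt (s := Set.univ)
      |>.differentiableWithinAt_mpullbackWithin_vectorField
    rw [hu] at this
    exact differentiableWithinAt_univ.1 this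
  have sf : ContDiffAt ℝ 2 (f ∘ φ.symm) (φ x) := by
    have h1 := (contMDiffAt_iff_source (I := I)).1 hf
    rw [I.range_eq_univ, contMDiffWithinAt_univ] at h1
    exact h1.contDiffAt
  -- Read in the chart, `U f` is the derivative of `f ∘ φ⁻¹` along the pulled-back field. This is
  -- needed on a neighbourhood because `U f` is differentiated again.
  have hev : ∀ U : ∀ x : N, TangentSpace I x,
      ((fun y ↦ mvfderiv I f y (U y)) ∘ φ.symm) =ᶠ[𝓝 (φ x)] fun z ↦ fderiv ℝ (f ∘ φ.symm) z
        (VectorField.mpullbackWithin 𝓘(ℝ, E) I φ.symm U (Set.range I) z) := by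
    intro U
    have h1 : ∀ᶠ y in 𝓝 x, MDifferentiableAt I 𝓘(ℝ, F) f y := by
      filter_upwards [(contMDiffAt_iff_contMDiffAt_nhds (by simp)).1 hf] with y hy
        using hy.mdifferentiableAt (by simp)
    have h2 : ∀ᶠ z in 𝓝 (φ x), MDifferentiableAt I 𝓘(ℝ, F) f (φ.symm z) := by
      have := continuousAt_extChartAt_symm (I := I) x
      rw [ContinuousAt, extChartAt_to_inv] at this
      exact this.eventually h1
    filter_upwards [h2, extChartAt_target_mem_nhds (I := I) x] with z hz hz'
    exact (fderiv_comp_extChartAt_symm_mpullback U hz' hz).symm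
  have hd : DifferentiableAt ℝ (fderiv ℝ (f ∘ φ.symm)) (φ x) :=
    (sf.fderiv_right (m := 1) (by norm_num)).differentiableAt (by norm_num)
  have key : ∀ U : ∀ x : N, TangentSpace I x, DifferentiableAt ℝ
      (VectorField.mpullbackWithin 𝓘(ℝ, E) I φ.symm U (Set.range I)) (φ x) →
      ∀ v : TangentSpace I x, mvfderiv I (fun y ↦ mvfderiv I f y (U y)) x v =
        fderiv ℝ (fun z ↦ fderiv ℝ (f ∘ φ.symm) z
          (VectorField.mpullbackWithin 𝓘(ℝ, E) I φ.symm U (Set.range I) z)) (φ x) v := by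
    intro U dU v
    have hd' := (hd.clm_apply dU).congr_of_eventuallyEq (hev U)
    rw [mvfderiv_eq_fderiv_extChartAt (mdifferentiableAt_of_comp_extChartAt_symm hd'),
      (hev U).fderiv_eq]
  have hval : ∀ U : ∀ x : N, TangentSpace I x,
      VectorField.mpullbackWithin 𝓘(ℝ, E) I φ.symm U (Set.range I) (φ x) = U x := by
    intro U
    rw [VectorField.mpullbackWithin_apply]
    have h1 : φ.symm (φ x) = x := extChartAt_to_inv x
    have h2 := mfderivWithin_extChartAt_symm_inverse_apply (I := I) (U x)
    have h3 : ∀ z, z = x → (ContinuousLinearMap.inverse (mfderivWithin 𝓘(ℝ, E) I φ.symm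
      (Set.range I) (φ x)) (U z : E) : E) =
      (ContinuousLinearMap.inverse (mfderivWithin 𝓘(ℝ, E) I φ.symm
      (Set.range I) (φ x)) (U x : E) : E) := by
      rintro z rfl; rfl
    exact (h3 _ h1).trans h2
  rw [key V dV, key W dW, mvfderiv_eq_fderiv_extChartAt (hf.mdifferentiableAt (by simp))]
  have hb : (VectorField.mlieBracket I V W x : E) = VectorField.lieBracket ℝ V' W' (φ x) := by
    rw [← VectorField.mlieBracketWithin_univ, VectorField.mlieBracketWithin_apply]
    -- The preferred chart at `x` has derivative the identity at `x`, so the manifold bracket at `x`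
    -- is literally the bracket in the chart.
    have hid : ∀ w : E, ContinuousLinearMap.inverse
        (mfderiv I 𝓘(ℝ, E) (extChartAt I x) x : E →L[ℝ] E) w = w := by
      have h : ∀ A : E →L[ℝ] E, A = ContinuousLinearMap.id ℝ E → ∀ w, A.inverse w = w := by
        rintro A rfl w
        rw [ContinuousLinearMap.inverse_id]
        rfl
      exact h _ mfderiv_extChartAt_self
    rw [hu]
    exact (hid _).trans (congrFun VectorField.lieBracketWithin_univ (φ x))
  have := fderiv_lieBracket sf dV dW
  have hvV : V' (φ x) = V x := hval V
  have hvW : W' (φ x) = W x := hval W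
  rw [hvV, hvW, ← hb] at this
  exact this

end Bracket

/-! ### Smooth sections over the slit tangent bundle and the vertical lift. -/

section Smoothness

variable {E : Type*} [NormedAddCommGroup E] [NormedSpace ℝ E]
  {M : Type*} [TopologicalSpace M] [ChartedSpace E M] [IsManifold 𝓘(ℝ, E) ∞ M]

instance instIsManifoldMinSmoothnessTwo :
    IsManifold 𝓘(ℝ, E).tangent (minSmoothness ℝ 2) (TM E M) := by
  rw [minSmoothness_of_isRCLikeNormedField]
  infer_instance

instance instIsManifoldMinSmoothnessThree :
    IsManifold 𝓘(ℝ, E).tangent (minSmoothness ℝ 3) (TM E M) := by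
  rw [minSmoothness_of_isRCLikeNormedField]
  infer_instance

instance instIsManifoldTangentInfinityAddOne : IsManifold 𝓘(ℝ, E).tangent (∞ + 1) (TM E M) :=
  inferInstanceAs (IsManifold 𝓘(ℝ, E).tangent ∞ (TM E M))

/-- `V` is a vector field on `TM`, smooth on the slit tangent bundle. -/
def IsTVectorField (V : TField E M) : Prop :=
  ContMDiffOn 𝓘(ℝ, E).tangent 𝓘(ℝ, E).tangent.tangent ∞
    (fun u ↦ (⟨u, V u⟩ : TangentBundle 𝓘(ℝ, E).tangent (TM E M))) (slit E M)

theorem isOpen_slit : IsOpen (slit E M) := by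
  rw [isOpen_iff_mem_nhds]
  intro u hu
  set e := trivializationAt E (TangentSpace 𝓘(ℝ, E) : M → Type _) u.proj
  have hub : u.proj ∈ e.baseSet := mem_baseSet_trivializationAt E _ _
  have hc : ContinuousAt (fun v : TM E M ↦ (e v).2) u :=
    continuous_snd.continuousAt.comp (e.continuousAt (e.mem_source.2 hub))
  have h0 : (e u).2 ≠ 0 := by
    have : (e u).2 = e.continuousLinearEquivAt ℝ u.proj hub u.2 := rfl
    rw [this]
    exact fun h ↦ hu ((e.continuousLinearEquivAt ℝ u.proj hub).map_eq_zero_iff.1 h)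
  have hp : ∀ᶠ v : TM E M in 𝓝 u, v.proj ∈ e.baseSet :=
    (FiberBundle.continuous_proj E (TangentSpace 𝓘(ℝ, E) : M → Type _)).continuousAt.eventually
      (e.open_baseSet.mem_nhds hub)
  filter_upwards [hc.eventually_ne h0, hp] with v hv hvb h
  apply hv
  have : (e v).2 = e.continuousLinearEquivAt ℝ v.proj hvb v.2 := rfl
  rw [this, h, map_zero]

theorem slit_mem_nhds {u : TM E M} (hu : u ∈ slit E M) : slit E M ∈ 𝓝 u :=
  isOpen_slit.mem_nhds hu

/-- A section of `π⁻¹(TM)` is smooth iff it is smooth as a map `TM → TM` over `π`. -/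
theorem contMDiffAt_piField_iff {Y : PiField E M} {u : TM E M} :
    ContMDiffAt 𝓘(ℝ, E).tangent (𝓘(ℝ, E).tangent.prod 𝓘(ℝ, E)) ∞
      (fun u ↦ (⟨u, Y u⟩ : TotalSpace E (PiBundle E M))) u ↔
    ContMDiffAt 𝓘(ℝ, E).tangent 𝓘(ℝ, E).tangent ∞
      (fun u : TM E M ↦ (⟨u.proj, Y u⟩ : TM E M)) u := by
  refine (contMDiffAt_section (F := E) (E := PiBundle E M) u).trans ?_
  rw [contMDiffAt_totalSpace]
  exact (and_iff_right ((proj E M).contMDiff.contMDiffAt (x := u))).symm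

theorem isPiVectorField_iff {Y : PiField E M} : IsPiVectorField Y ↔ ∀ u ∈ slit E M,
    ContMDiffAt 𝓘(ℝ, E).tangent 𝓘(ℝ, E).tangent ∞
      (fun u : TM E M ↦ (⟨u.proj, Y u⟩ : TM E M)) u := by
  refine forall₂_congr fun u hu ↦ ?_
  rw [← contMDiffAt_piField_iff]
  exact ⟨fun h ↦ h.contMDiffAt (slit_mem_nhds hu), fun h ↦ h.contMDiffWithinAt⟩

theorem IsPiVectorField.contMDiffAt {Y : PiField E M} (hY : IsPiVectorField Y) {u : TM E M}
    (hu : u ∈ slit E M) : ContMDiffAt 𝓘(ℝ, E).tangent (𝓘(ℝ, E).tangent.prod 𝓘(ℝ, E)) ∞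
      (fun u ↦ (⟨u, Y u⟩ : TotalSpace E (PiBundle E M))) u :=
  ContMDiffOn.contMDiffAt hY (slit_mem_nhds hu)

theorem IsPiVectorField.mdifferentiableAt {Y : PiField E M} (hY : IsPiVectorField Y) {u : TM E M}
    (hu : u ∈ slit E M) : MDifferentiableAt 𝓘(ℝ, E).tangent (𝓘(ℝ, E).tangent.prod 𝓘(ℝ, E))
      (fun u ↦ (⟨u, Y u⟩ : TotalSpace E (PiBundle E M))) u :=
  (hY.contMDiffAt hu).mdifferentiableAt (by simp)

theorem IsTVectorField.contMDiffAt {V : TField E M} (hV : IsTVectorField V) {u : TM E M}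
    (hu : u ∈ slit E M) : ContMDiffAt 𝓘(ℝ, E).tangent 𝓘(ℝ, E).tangent.tangent ∞
      (fun u ↦ (⟨u, V u⟩ : TangentBundle 𝓘(ℝ, E).tangent (TM E M))) u :=
  ContMDiffOn.contMDiffAt hV (slit_mem_nhds hu)

theorem IsTVectorField.mdifferentiableAt {V : TField E M} (hV : IsTVectorField V) {u : TM E M}
    (hu : u ∈ slit E M) : MDifferentiableAt 𝓘(ℝ, E).tangent 𝓘(ℝ, E).tangent.tangent
      (fun u ↦ (⟨u, V u⟩ : TangentBundle 𝓘(ℝ, E).tangent (TM E M))) u :=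
  (hV.contMDiffAt hu).mdifferentiableAt (by simp)

theorem isPiVectorField_eta : IsPiVectorField (eta : PiField E M) :=
  isPiVectorField_iff.2 fun _ _ ↦
    contMDiffAt_id (I := 𝓘(ℝ, E).tangent) (M := TM E M)

theorem IsPiVectorField.congr {X Y : PiField E M} (hX : IsPiVectorField X)
    (h : ∀ u ∈ slit E M, Y u = X u) : IsPiVectorField Y :=
  ContMDiffOn.congr hX fun u hu ↦ by rw [h u hu]

theorem IsPiVectorField.add {X Y : PiField E M} (hX : IsPiVectorField X) (hY : IsPiVectorField Y) :
    IsPiVectorField (X + Y) :=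
  ContMDiffOn.add_section hX hY

theorem IsPiVectorField.sub {X Y : PiField E M} (hX : IsPiVectorField X) (hY : IsPiVectorField Y) :
    IsPiVectorField (X - Y) :=
  ContMDiffOn.sub_section hX hY

theorem IsPiVectorField.neg {X : PiField E M} (hX : IsPiVectorField X) :
    IsPiVectorField (-X) :=
  ContMDiffOn.neg_section hX

theorem IsPiVectorField.smul {f : TM E M → ℝ} {X : PiField E M}
    (hf : ContMDiffOn 𝓘(ℝ, E).tangent 𝓘(ℝ) ∞ f (slit E M)) (hX : IsPiVectorField X) :
    IsPiVectorField (f • X) :=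
  ContMDiffOn.smul_section hf hX

theorem IsTVectorField.rho {V : TField E M} (hV : IsTVectorField V) :
    IsPiVectorField fun u ↦ rho u (V u) := by
  rw [isPiVectorField_iff]
  intro u hu
  have h := ((proj E M).contMDiff.contMDiff_tangentMap (m := ∞) (by simp)).contMDiffAt.comp u
    (hV.contMDiffAt hu)
  exact h

theorem IsTVectorField.mlieBracket [CompleteSpace E] {V W : TField E M} (hV : IsTVectorField V)
    (hW : IsTVectorField W) :
    IsTVectorField (VectorField.mlieBracket 𝓘(ℝ, E).tangent V W) := by
  intro u hu
  refine ContMDiffAt.contMDiffWithinAt ?_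
  exact ContMDiffAt.mlieBracket_vectorField (m := ⊤) (n := ⊤) (hV.contMDiffAt hu)
    (hW.contMDiffAt hu) (by simp)

theorem IsTVectorField.mvfderiv {F : Type*} [NormedAddCommGroup F] [NormedSpace ℝ F]
    {V : TField E M} (hV : IsTVectorField V) {f : TM E M → F}
    (hf : ContMDiffOn 𝓘(ℝ, E).tangent 𝓘(ℝ, F) ∞ f (slit E M)) :
    ContMDiffOn 𝓘(ℝ, E).tangent 𝓘(ℝ, F) ∞
      (fun u ↦ mvfderiv 𝓘(ℝ, E).tangent f u (V u)) (slit E M) := by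
  have h := (hf.contMDiffOn_tangentMapWithin (m := ∞) (by simp) isOpen_slit.uniqueMDiffOn).comp hV
    (fun u hu ↦ hu)
  have h2 := (contMDiff_snd_tangentBundle_modelSpace F 𝓘(ℝ, F)).comp_contMDiffOn h
  refine h2.congr fun u hu ↦ ?_
  have : mfderivWithin 𝓘(ℝ, E).tangent 𝓘(ℝ, F) f (slit E M) u =
      mfderiv 𝓘(ℝ, E).tangent 𝓘(ℝ, F) f u :=
    mfderivWithin_of_isOpen isOpen_slit hu
  exact congrArg (fun A ↦ A (V u)) this.symm

/-! ### The fibres -/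

theorem contMDiff_fibre (x : M) : ContMDiff 𝓘(ℝ, E) 𝓘(ℝ, E).tangent ∞
    (fun w : E ↦ (⟨x, w⟩ : TM E M)) := by
  intro w
  rw [contMDiffAt_totalSpace]
  refine ⟨contMDiffAt_const, ?_⟩
  set e := trivializationAt E (TangentSpace 𝓘(ℝ, E) : M → Type _) x
  have hub : x ∈ e.baseSet := mem_baseSet_trivializationAt E _ _
  let A : E →L[ℝ] E := (e.continuousLinearEquivAt ℝ x hub).toContinuousLinearMap
  exact A.contDiff.contMDiff.contMDiffAt

theorem mdifferentiableAt_fibre (x : M) (w : E) : MDifferentiableAt 𝓘(ℝ, E) 𝓘(ℝ, E).tangent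
    (fun w : E ↦ (⟨x, w⟩ : TM E M)) w :=
  (contMDiff_fibre x).contMDiffAt.mdifferentiableAt (by simp)

theorem mvfderiv_gamma {F : Type*} [NormedAddCommGroup F] [NormedSpace ℝ F] {f : TM E M → F}
    {u : TM E M} (hf : MDifferentiableAt 𝓘(ℝ, E).tangent 𝓘(ℝ, F) f u) (w : PiBundle E M u) :
    mvfderiv 𝓘(ℝ, E).tangent f u (gamma u w) =
      fderiv ℝ (fun z : E ↦ f (⟨u.1, z⟩ : TM E M)) (u.2 : E) w := by
  have h : ∀ (x : M) (y : E), MDifferentiableAt 𝓘(ℝ, E).tangent 𝓘(ℝ, F) f (⟨x, y⟩ : TM E M) →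
      fderiv ℝ (fun z : E ↦ f (⟨x, z⟩ : TM E M)) y =
      (mfderiv 𝓘(ℝ, E).tangent 𝓘(ℝ, F) f (⟨x, y⟩ : TM E M)).comp
        (mfderiv 𝓘(ℝ, E) 𝓘(ℝ, E).tangent (fun w : E ↦ (⟨x, w⟩ : TM E M)) y) := by
    intro x y hf
    rw [← mfderiv_eq_fderiv]
    exact mfderiv_comp y hf (mdifferentiableAt_fibre x y)
  exact (congrArg (fun A : E →L[ℝ] F ↦ A w) (h u.1 u.2 hf)).symm

theorem rho_gamma (u : TM E M) (w : PiBundle E M u) : rho u (gamma u w) = 0 := by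
  have h : ∀ (x : M) (y : E), (mfderiv 𝓘(ℝ, E).tangent 𝓘(ℝ, E) (proj E M) (⟨x, y⟩ : TM E M)).comp
        (mfderiv 𝓘(ℝ, E) 𝓘(ℝ, E).tangent (fun w : E ↦ (⟨x, w⟩ : TM E M)) y) = 0 := by
    intro x y
    rw [← mfderiv_comp y (proj E M).mdifferentiableAt (mdifferentiableAt_fibre x y)]
    exact mfderiv_const
  exact congrArg (fun A : E →L[ℝ] E ↦ A w) (h u.1 u.2)

/-- A smooth section of `π⁻¹(TM)`, restricted to a fibre of `TM`. -/
theorem IsPiVectorField.contDiffAt_fibre {Y : PiField E M} (hY : IsPiVectorField Y) {u : TM E M}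
    (hu : u ∈ slit E M) : ContDiffAt ℝ ∞ (fun z : E ↦ (Y (⟨u.1, z⟩ : TM E M) : E)) (u.2 : E) := by
  have h1 := isPiVectorField_iff.1 hY u hu
  obtain ⟨x, y⟩ := u
  have h2 : ∀ y : E, ContMDiffAt 𝓘(ℝ, E).tangent 𝓘(ℝ, E).tangent ∞
      (fun u : TM E M ↦ (⟨u.proj, Y u⟩ : TM E M)) (⟨x, y⟩ : TM E M) →
      ContDiffAt ℝ ∞ (fun z : E ↦ (Y (⟨x, z⟩ : TM E M) : E)) y := by
    intro y h1
    have h2 := h1.comp y (contMDiff_fibre x).contMDiffAt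
    have h3 := (contMDiffAt_totalSpace.1 h2).2
    set e := trivializationAt E (TangentSpace 𝓘(ℝ, E) : M → Type _) x
    have hub : x ∈ e.baseSet := mem_baseSet_trivializationAt E _ _
    let A : E →L[ℝ] E := (e.continuousLinearEquivAt ℝ x hub).symm.toContinuousLinearMap
    have h4 := A.contDiff.contMDiff.contMDiffAt.comp y h3
    refine (contMDiffAt_iff_contDiffAt.1 h4).congr_of_eventuallyEq (Filter.Eventually.of_forall ?_)
    intro z
    exact ((e.continuousLinearEquivAt ℝ x hub).symm_apply_apply _).symm
  exact h2 y h1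

/-- The translation of `u ∈ TM` by `t X(u)` in its fibre. -/
noncomputable def translate (X : PiField E M) (u : TM E M) (t : ℝ) : TM E M :=
  ⟨u.proj, u.2 + t • (show TangentSpace 𝓘(ℝ, E) u.proj from X u)⟩

theorem contMDiffAt_translate {X : PiField E M} (hX : IsPiVectorField X) {u : TM E M}
    (hu : u ∈ slit E M) : ContMDiffAt (𝓘(ℝ, E).tangent.prod 𝓘(ℝ)) 𝓘(ℝ, E).tangent ∞
      (Function.uncurry (translate X)) (u, 0) := by
  rw [contMDiffAt_totalSpace]
  refine ⟨(proj E M).contMDiff.contMDiffAt.comp (u, (0 : ℝ)) contMDiffAt_fst, ?_⟩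
  set e := trivializationAt E (TangentSpace 𝓘(ℝ, E) : M → Type _) u.proj
  have hub : u.proj ∈ e.baseSet := mem_baseSet_trivializationAt E _ _
  have h1 : ContMDiffAt 𝓘(ℝ, E).tangent 𝓘(ℝ, E) ∞ (fun v : TM E M ↦ (e v).2) u :=
    (contMDiffAt_totalSpace.1 (contMDiffAt_id (I := 𝓘(ℝ, E).tangent))).2
  have h2 : ContMDiffAt 𝓘(ℝ, E).tangent 𝓘(ℝ, E) ∞ (fun v : TM E M ↦ (e ⟨v.proj, X v⟩).2) u :=
    (contMDiffAt_totalSpace.1 (isPiVectorField_iff.1 hX u hu)).2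
  have h3 := (h1.comp (I := 𝓘(ℝ, E).tangent.prod 𝓘(ℝ)) (u, (0 : ℝ)) contMDiffAt_fst).add
    ((contMDiffAt_snd (I := 𝓘(ℝ, E).tangent) (J := 𝓘(ℝ)) (p := (u, (0 : ℝ)))).smul
    (h2.comp (I := 𝓘(ℝ, E).tangent.prod 𝓘(ℝ)) (u, (0 : ℝ)) contMDiffAt_fst))
  have hp : ∀ᶠ v : TM E M in 𝓝 u, v.proj ∈ e.baseSet :=
    (FiberBundle.continuous_proj E (TangentSpace 𝓘(ℝ, E) : M → Type _)).continuousAt.eventually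
      (e.open_baseSet.mem_nhds hub)
  have hev : (fun p : TM E M × ℝ ↦ (e (Function.uncurry (translate X) p)).2) =ᶠ[𝓝 (u, (0 : ℝ))]
      fun p : TM E M × ℝ ↦ (e p.1).2 + p.2 • (e ⟨p.1.proj, X p.1⟩).2 := by
    filter_upwards [(continuousAt_fst (p := (u, (0 : ℝ)))).eventually hp] with p hp
    have : (e.continuousLinearEquivAt ℝ p.1.proj hp)
        (p.1.2 + p.2 • (show TangentSpace 𝓘(ℝ, E) p.1.proj from X p.1)) =
      (e.continuousLinearEquivAt ℝ p.1.proj hp) p.1.2 +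
      p.2 • (e.continuousLinearEquivAt ℝ p.1.proj hp) (X p.1) := by
      rw [map_add, map_smul]
    exact this
  exact h3.congr_of_eventuallyEq hev

theorem tangentMap_translate (X : PiField E M) (u : TM E M) :
    tangentMap 𝓘(ℝ) 𝓘(ℝ, E).tangent (translate X u) ⟨0, (1 : ℝ)⟩ =
      (⟨u, vert X u⟩ : TangentBundle 𝓘(ℝ, E).tangent (TM E M)) := by
  have h : ∀ (x : M) (y z : E),
      tangentMap 𝓘(ℝ) 𝓘(ℝ, E).tangent (fun t : ℝ ↦ (⟨x, y + t • z⟩ : TM E M)) ⟨0, (1 : ℝ)⟩ =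
      (⟨⟨x, y⟩, mfderiv 𝓘(ℝ, E) 𝓘(ℝ, E).tangent (fun w : E ↦ (⟨x, w⟩ : TM E M)) y z⟩ :
        TangentBundle 𝓘(ℝ, E).tangent (TM E M)) := by
    intro x y z
    have hd : HasDerivAt (fun t : ℝ ↦ y + t • z) z 0 := by
      simpa using ((hasDerivAt_id (0 : ℝ)).smul_const z).const_add y
    have h1 := tangentMap_comp_at (⟨0, (1 : ℝ)⟩ : TangentBundle 𝓘(ℝ) ℝ)
      (g := fun w : E ↦ (⟨x, w⟩ : TM E M)) (f := fun t : ℝ ↦ y + t • z) (I' := 𝓘(ℝ, E))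
      (I'' := 𝓘(ℝ, E).tangent) (mdifferentiableAt_fibre x _)
      hd.differentiableAt.mdifferentiableAt
    have h2 : tangentMap 𝓘(ℝ) 𝓘(ℝ, E) (fun t : ℝ ↦ y + t • z) ⟨0, (1 : ℝ)⟩ = ⟨y, z⟩ := by
      have h3 : mfderiv 𝓘(ℝ) 𝓘(ℝ, E) (fun t : ℝ ↦ y + t • z) 0 (1 : ℝ) = z := by
        rw [mfderiv_eq_fderiv]
        exact hd.deriv
      have h4 : y + (0 : ℝ) • z = y := by simp
      have h5 : ∀ (a b c d : E), a = c → b = d →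
        (⟨a, b⟩ : TangentBundle 𝓘(ℝ, E) E) = ⟨c, d⟩ := by rintro a b _ _ rfl rfl; rfl
      exact h5 _ _ _ _ h4 h3
    rw [h2] at h1
    exact h1
  exact h u.1 u.2 (X u)

/-- `γX(u)` is the velocity at `t = 0` of the curve `translate X u`. This family is jointly smooth
in `(u, t)`, so its `t`-derivative is smooth in `u`. -/
theorem IsPiVectorField.vert {X : PiField E M} (hX : IsPiVectorField X) :
    IsTVectorField (vert X) := by
  intro u hu
  refine ContMDiffAt.contMDiffWithinAt ?_
  have hf := contMDiffAt_translate hX hu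
  have h1 := ContMDiffAt.mfderiv (m := ∞) (translate X) (fun _ ↦ (0 : ℝ)) hf contMDiffAt_const
    (by simp)
  have h2 : ContMDiffAt 𝓘(ℝ, E).tangent 𝓘(ℝ, E).tangent ∞ (fun v ↦ translate X v 0) u :=
    hf.comp (I' := 𝓘(ℝ, E).tangent.prod 𝓘(ℝ)) u
      ((contMDiffAt_id (I := 𝓘(ℝ, E).tangent)).prodMk contMDiffAt_const)
  have h0 : ContMDiffAt 𝓘(ℝ, E).tangent 𝓘(ℝ).tangent ∞
      (fun _ ↦ (⟨0, (1 : ℝ)⟩ : TangentBundle 𝓘(ℝ) ℝ)) u := contMDiffAt_const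
  have h3 : ContMDiffAt 𝓘(ℝ, E).tangent 𝓘(ℝ, E).tangent.tangent ∞
      (fun v ↦ tangentMap 𝓘(ℝ) 𝓘(ℝ, E).tangent (translate X v) ⟨0, (1 : ℝ)⟩) u := by
    refine ContMDiffAt.clm_apply_of_inCoordinates (IB₁ := 𝓘(ℝ)) (IB₂ := 𝓘(ℝ, E).tangent)
      (F₁ := ℝ) (F₂ := E × E) (E₁ := TangentSpace 𝓘(ℝ)) (E₂ := TangentSpace 𝓘(ℝ, E).tangent)
      (b₁ := fun _ ↦ (0 : ℝ)) (b₂ := fun v ↦ translate X v 0)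
      (ϕ := fun v ↦ mfderiv 𝓘(ℝ) 𝓘(ℝ, E).tangent (translate X v) 0)
      (v := fun _ ↦ (1 : ℝ)) ?_ ?_ ?_
    · exact h1
    · exact h0
    · exact h2
  simp only [tangentMap_translate] at h3
  exact h3

end Smoothness

/-! ### The horizontal lift and its smoothness. -/

section Beta

variable {E : Type*} [NormedAddCommGroup E] [NormedSpace ℝ E]
  {M : Type*} [TopologicalSpace M] [ChartedSpace E M] [IsManifold 𝓘(ℝ, E) ∞ M]

theorem contMDiffAt_mvfderiv_apply {F : Type*} [NormedAddCommGroup F] [NormedSpace ℝ F]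
    {V : TField E M} {u : TM E M} (hV : ContMDiffAt 𝓘(ℝ, E).tangent 𝓘(ℝ, E).tangent.tangent ∞
      (fun u ↦ (⟨u, V u⟩ : TangentBundle 𝓘(ℝ, E).tangent (TM E M))) u) {f : TM E M → F}
    (hf : ContMDiffAt 𝓘(ℝ, E).tangent 𝓘(ℝ, F) ∞ f u) :
    ContMDiffAt 𝓘(ℝ, E).tangent 𝓘(ℝ, F) ∞
      (fun u ↦ mvfderiv 𝓘(ℝ, E).tangent f u (V u)) u := by
  have h1 := hf.mfderiv_const (m := ∞) (by simp)
  have h2 : ContMDiffAt 𝓘(ℝ, E).tangent 𝓘(ℝ, F).tangent ∞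
      (fun v ↦ (⟨f v, mfderiv 𝓘(ℝ, E).tangent 𝓘(ℝ, F) f v (V v)⟩ : TangentBundle 𝓘(ℝ, F) F)) u :=
    ContMDiffAt.clm_apply_of_inCoordinates (IB₁ := 𝓘(ℝ, E).tangent) (IB₂ := 𝓘(ℝ, F))
      (F₁ := E × E) (F₂ := F) (E₁ := TangentSpace 𝓘(ℝ, E).tangent) (E₂ := TangentSpace 𝓘(ℝ, F))
      (b₁ := fun v ↦ v) (b₂ := f) (ϕ := fun v ↦ mfderiv 𝓘(ℝ, E).tangent 𝓘(ℝ, F) f v)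
      (v := V) h1 hV hf
  exact (contMDiff_snd_tangentBundle_modelSpace F 𝓘(ℝ, F)).contMDiffAt.comp u h2

/-- A local section `s` of `TM` through `u`, constant in a trivialization, satisfies `π ∘ s = id`
near the base point, so its derivative is a right inverse of `dπ`. -/
theorem rho_surjective (u : TM E M) : Function.Surjective (rho u) := by
  set e := trivializationAt E (TangentSpace 𝓘(ℝ, E) : M → Type _) u.proj
  have hub : u.proj ∈ e.baseSet := mem_baseSet_trivializationAt E _ _
  let s : M → TM E M := fun x ↦ e.toOpenPartialHomeomorph.symm (x, (e u).2)
  have hs0 : s u.proj = u := by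
    have h1 : (u.proj, (e u).2) = e u := e.mk_proj_snd (e.mem_source.2 hub)
    change e.toOpenPartialHomeomorph.symm (u.proj, (e u).2) = u
    rw [h1]
    exact e.toOpenPartialHomeomorph.left_inv (e.mem_source.2 hub)
  have hs : ContMDiffAt 𝓘(ℝ, E) 𝓘(ℝ, E).tangent ∞ s u.proj := by
    have h1 := (e.contMDiffOn_symm (IB := 𝓘(ℝ, E)) (n := ∞)).contMDiffAt (x := (u.proj, (e u).2))
      (e.open_target.mem_nhds (e.mem_target.2 hub))
    exact h1.comp u.proj (contMDiffAt_id.prodMk contMDiffAt_const)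
  have hcomp : mfderiv 𝓘(ℝ, E) 𝓘(ℝ, E) (proj E M ∘ s) u.proj =
      ContinuousLinearMap.id ℝ (TangentSpace 𝓘(ℝ, E) u.proj) := by
    have : (proj E M ∘ s) =ᶠ[𝓝 u.proj] id := by
      filter_upwards [e.open_baseSet.mem_nhds hub] with x hx
      exact e.proj_symm_apply (x := (x, (e u).2)) (e.mem_target.2 hx)
    rw [this.mfderiv_eq]
    exact mfderiv_id
  have key : ∀ v : TM E M, s u.proj = v → ∀ w : E, ∃ z, rho v z = w := by
    rintro v rfl w
    refine ⟨mfderiv 𝓘(ℝ, E) 𝓘(ℝ, E).tangent s u.proj w, ?_⟩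
    have h2 := mfderiv_comp u.proj (g := proj E M) (f := s) (proj E M).mdifferentiableAt
      (hs.mdifferentiableAt (by simp))
    rw [hcomp] at h2
    exact (congrArg (fun A : E →L[ℝ] E ↦ A w) h2).symm
  exact key u hs0

variable {D : ConnOp E M}

theorem connMap_beta (u : TM E M) (w : PiBundle E M u) : connMap D u (beta D u w) = 0 :=
  ((rho u ∘L (connMap D u).ker.subtypeL).inverse w).2

theorem IsRegular.eq_zero (hD : IsRegular D) {u : TM E M} (hu : u ∈ slit E M)
    {V : TangentSpace 𝓘(ℝ, E).tangent u} (h1 : rho u V = 0) (h2 : connMap D u V = 0) : V = 0 :=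
  (Submodule.disjoint_def.1 (hD u hu).disjoint) V h1 h2

/-- On a complement of its kernel the surjection `ρ` is bijective. Finite dimension makes the
inverse continuous, so `ContinuousLinearMap.inverse` does not take its default value `0`. -/
theorem IsRegular.rho_beta [FiniteDimensional ℝ E] (hD : IsRegular D) {u : TM E M}
    (hu : u ∈ slit E M) (w : PiBundle E M u) : rho u (beta D u w) = w := by
  have : T2Space (TangentSpace 𝓘(ℝ, E).tangent u) := inferInstanceAs (T2Space (E × E))
  have : FiniteDimensional ℝ (TangentSpace 𝓘(ℝ, E).tangent u) :=
    inferInstanceAs (FiniteDimensional ℝ (E × E))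
  have : T2Space (PiBundle E M u) := inferInstanceAs (T2Space E)
  have : FiniteDimensional ℝ (PiBundle E M u) := inferInstanceAs (FiniteDimensional ℝ E)
  set A := rho u ∘L (connMap D u).ker.subtypeL with hA
  have hinj : Function.Injective A := by
    rw [injective_iff_map_eq_zero]
    intro V hV
    exact Subtype.ext (hD.eq_zero hu hV V.2)
  have hsurj : Function.Surjective A := by
    intro w
    obtain ⟨V, hV⟩ := rho_surjective u w
    obtain ⟨a, b, ha, hb, hab⟩ := Submodule.codisjoint_iff_exists_add_eq.1 (hD u hu).codisjoint V
    refine ⟨⟨b, hb⟩, ?_⟩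
    have : rho u a = 0 := ha
    rw [← hV, ← hab, map_add, this, zero_add]
    rfl
  have hinv : A.IsInvertible :=
    ⟨(LinearEquiv.ofBijective (A : (connMap D u).ker →ₗ[ℝ] PiBundle E M u)
      ⟨hinj, hsurj⟩).toContinuousLinearEquiv, by ext; rfl⟩
  exact hinv.self_apply_inverse w

theorem contMDiffOn_conn (hD : IsLinearConnection D) {Z : PiField E M} (hZ : IsPiVectorField Z)
    {V : TField E M} (hV : IsTVectorField V) : IsPiVectorField fun u ↦ D Z u (V u) :=
  ContMDiffOn.clm_bundle_apply (hD.contMDiff.contMDiff hZ) hV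

theorem contMDiffAt_inCoordinates_rho (u : TM E M) :
    ContMDiffAt 𝓘(ℝ, E).tangent 𝓘(ℝ, E × E →L[ℝ] E) ∞
      (fun v ↦ ContinuousLinearMap.inCoordinates (E × E) (TangentSpace 𝓘(ℝ, E).tangent) E
        (PiBundle E M) u v u v (rho v)) u :=
  (proj E M).contMDiff.contMDiffAt.mfderiv_const (m := ∞) (by simp)

theorem contMDiffAt_inCoordinates_connMap (hD : IsLinearConnection D) {u : TM E M}
    (hu : u ∈ slit E M) :
    ContMDiffAt 𝓘(ℝ, E).tangent 𝓘(ℝ, E × E →L[ℝ] E) ∞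
      (fun v ↦ ContinuousLinearMap.inCoordinates (E × E) (TangentSpace 𝓘(ℝ, E).tangent) E
        (PiBundle E M) u v u v (connMap D v)) u :=
  ((contMDiffAt_hom_bundle _).1
    ((hD.contMDiff.contMDiff isPiVectorField_eta).contMDiffAt (slit_mem_nhds hu))).2

/-- By regularity the map `A = (ρ, K)`, read in trivializations, is an injective endomorphism of `E
× E`, hence invertible. It depends smoothly on the point, inversion of operators is smooth, and `βX
= A⁻¹(X, 0)`. -/
theorem IsPiVectorField.isTVectorField_horiz [FiniteDimensional ℝ E] (hD : IsLinearConnection D)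
    (hR : IsRegular D) {X : PiField E M} (hX : IsPiVectorField X) : IsTVectorField (horiz D X) := by
  intro u hu
  refine ContMDiffAt.contMDiffWithinAt ?_
  rw [contMDiffAt_section]
  set e₁ := trivializationAt (E × E)
    (TangentSpace 𝓘(ℝ, E).tangent : TM E M → Type _) u with he₁
  set e₂ := trivializationAt E (PiBundle E M) u with he₂
  have hu₁ : u ∈ e₁.baseSet := mem_baseSet_trivializationAt _ _ _
  have hu₂ : u ∈ e₂.baseSet := mem_baseSet_trivializationAt _ _ _
  let A : TM E M → E × E →L[ℝ] E × E := fun v ↦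
    (ContinuousLinearMap.inCoordinates (E × E) (TangentSpace 𝓘(ℝ, E).tangent) E
        (PiBundle E M) u v u v (rho v)).prod
    (ContinuousLinearMap.inCoordinates (E × E) (TangentSpace 𝓘(ℝ, E).tangent) E
        (PiBundle E M) u v u v (connMap D v))
  have hA : ContMDiffAt 𝓘(ℝ, E).tangent 𝓘(ℝ, E × E →L[ℝ] E × E) ∞ A u :=
    (ContinuousLinearMap.prodₗᵢ (𝕜 := ℝ) (E := E × E) (F := E) (G := E) ℝ
      ).contDiff.contMDiff.contMDiffAt.comp u
      ((contMDiffAt_inCoordinates_rho u).prodMk_space (contMDiffAt_inCoordinates_connMap hD hu))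
  have happly : ∀ v (hv₁ : v ∈ e₁.baseSet) (hv₂ : v ∈ e₂.baseSet) z,
      A v z = (e₂.continuousLinearEquivAt ℝ v hv₂
          (rho v ((e₁.continuousLinearEquivAt ℝ v hv₁).symm z)),
        e₂.continuousLinearEquivAt ℝ v hv₂
          (connMap D v ((e₁.continuousLinearEquivAt ℝ v hv₁).symm z))) := by
    intro v hv₁ hv₂ z
    have h1 := ContinuousLinearMap.inCoordinates_eq (ϕ := rho v) hv₁ hv₂
    have h2 := ContinuousLinearMap.inCoordinates_eq (ϕ := connMap D v) hv₁ hv₂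
    exact Prod.ext (congrArg (fun B ↦ B z) h1) (congrArg (fun B ↦ B z) h2)
  have hinv : ∀ v ∈ slit E M, v ∈ e₁.baseSet → v ∈ e₂.baseSet → (A v).IsInvertible := by
    intro v hv hv₁ hv₂
    have hinj : Function.Injective (A v : E × E →ₗ[ℝ] E × E) := by
      rw [injective_iff_map_eq_zero]
      intro z hz
      have hz' := (happly v hv₁ hv₂ z).symm.trans hz
      rw [Prod.mk_eq_zero, ContinuousLinearEquiv.map_eq_zero_iff,
        ContinuousLinearEquiv.map_eq_zero_iff] at hz'
      exact (ContinuousLinearEquiv.map_eq_zero_iff _).1 (hR.eq_zero hv hz'.1 hz'.2)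
    exact ⟨(LinearEquiv.ofInjectiveEndo _ hinj).toContinuousLinearEquiv, by ext <;> rfl⟩
  have hval : ∀ v ∈ slit E M, v ∈ e₁.baseSet → v ∈ e₂.baseSet →
      (A v) (e₁ ⟨v, horiz D X v⟩).2 = ((e₂ ⟨v, X v⟩).2, 0) := by
    intro v hv hv₁ hv₂
    have h1 : (e₁.continuousLinearEquivAt ℝ v hv₁).symm (e₁ ⟨v, horiz D X v⟩).2 = horiz D X v :=
      (e₁.continuousLinearEquivAt ℝ v hv₁).symm_apply_apply _
    have h2 : rho v (horiz D X v) = X v := hR.rho_beta hv _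
    have h3 : connMap D v (horiz D X v) = 0 := connMap_beta v _
    rw [happly v hv₁ hv₂, h1, h2, h3, map_zero]
    rfl
  have hX' := (contMDiffAt_section u).1 (hX.contMDiffAt hu)
  obtain ⟨a, ha⟩ := hinv u hu hu₁ hu₂
  have hc : ContMDiffAt 𝓘(ℝ, E).tangent 𝓘(ℝ, E × E →L[ℝ] E × E) ∞
      (fun v ↦ (A v).inverse) u := by
    have h1 : ContDiffAt ℝ ∞ ContinuousLinearMap.inverse (A u) := by
      rw [← ha]
      exact contDiffAt_map_inverse a
    exact h1.contMDiffAt.comp u hA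
  have h2 : ContMDiffAt 𝓘(ℝ, E).tangent 𝓘(ℝ, E × E) ∞
      (fun v ↦ (A v).inverse ((e₂ ⟨v, X v⟩).2, (0 : E))) u :=
    hc.clm_apply (hX'.prodMk_space contMDiffAt_const)
  refine h2.congr_of_eventuallyEq ?_
  filter_upwards [slit_mem_nhds hu, e₁.open_baseSet.mem_nhds hu₁, e₂.open_baseSet.mem_nhds hu₂]
    with v hv hv₁ hv₂
  rw [← hval v hv hv₁ hv₂, (hinv v hv hv₁ hv₂).inverse_apply_self]

end Beta

/-! ### Derivatives along the fibres and brackets with vertical fields. -/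

section Fibre

variable {E : Type*} [NormedAddCommGroup E] [NormedSpace ℝ E]
  {M : Type*} [TopologicalSpace M] [ChartedSpace E M] [IsManifold 𝓘(ℝ, E) ∞ M]

/-- The derivative of a `π`-vector field along the fibre of `TM`. -/
noncomputable def fibreDeriv (Y : PiField E M) (u : TM E M) (w : PiBundle E M u) :
    PiBundle E M u :=
  fderiv ℝ (fun z : E ↦ (Y (⟨u.1, z⟩ : TM E M) : E)) (u.2 : E) w

theorem fibreDeriv_eta (u : TM E M) (w : PiBundle E M u) : fibreDeriv eta u w = w := by
  have : ∀ y w : E, fderiv ℝ (fun z : E ↦ z) y w = w := by simp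
  exact this u.2 w

theorem eventually_fibre_mem_slit {x : M} {y : E} (hy : (⟨x, y⟩ : TM E M) ∈ slit E M) :
    ∀ᶠ z : E in 𝓝 y, (⟨x, z⟩ : TM E M) ∈ slit E M :=
  (contMDiff_fibre x).continuous.continuousAt.eventually (slit_mem_nhds hy)

theorem fibreDeriv_congr {Y Z : PiField E M} (h : ∀ u ∈ slit E M, Y u = Z u) {u : TM E M}
    (hu : u ∈ slit E M) (w : PiBundle E M u) : fibreDeriv Y u w = fibreDeriv Z u w := by
  have : ∀ (x : M) (y : E), (⟨x, y⟩ : TM E M) ∈ slit E M →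
      fderiv ℝ (fun z : E ↦ (Y (⟨x, z⟩ : TM E M) : E)) y =
        fderiv ℝ (fun z : E ↦ (Z (⟨x, z⟩ : TM E M) : E)) y := by
    intro x y hy
    refine Filter.EventuallyEq.fderiv_eq ?_
    filter_upwards [eventually_fibre_mem_slit hy] with z hz using h _ hz
  exact congrArg (fun A : E →L[ℝ] E ↦ A w) (this u.1 u.2 hu)

theorem mvfderiv_comp_proj {F : Type*} [NormedAddCommGroup F] [NormedSpace ℝ F] {f : M → F}
    {v : TM E M} (hf : MDifferentiableAt 𝓘(ℝ, E) 𝓘(ℝ, F) f v.proj)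
    (V : TangentSpace 𝓘(ℝ, E).tangent v) :
    mvfderiv 𝓘(ℝ, E).tangent (fun v : TM E M ↦ f (proj E M v)) v V =
      mvfderiv 𝓘(ℝ, E) f v.proj (rho v V) := by
  have h := mfderiv_comp v (g := f) (f := proj E M) hf (proj E M).mdifferentiableAt
  exact congrArg (fun A : TangentSpace 𝓘(ℝ, E).tangent v →L[ℝ] F ↦ A V) h

/-- The image under `dπ` of the bracket with a vertical field is a derivative along the fibre. -/
theorem rho_mlieBracket_vert [CompleteSpace E] {X : PiField E M} (hX : IsPiVectorField X)
    {W : TField E M} (hW : IsTVectorField W) {u : TM E M} (hu : u ∈ slit E M) :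
    rho u (VectorField.mlieBracket 𝓘(ℝ, E).tangent (vert X) W u) =
      fibreDeriv (fun v ↦ rho v (W v)) u (X u) := by
  set φ := extChartAt 𝓘(ℝ, E) u.proj
  -- The bracket is tested on a chart of `M` composed with `π`: vertical fields kill `f`, so `[γX,
  -- W] f = γX(W f)`.
  let f : TM E M → E := fun v ↦ φ (proj E M v)
  have hf : ContMDiffAt 𝓘(ℝ, E).tangent 𝓘(ℝ, E) ∞ f u :=
    (contMDiffAt_extChartAt (n := ∞)).comp u ((proj E M).contMDiff.contMDiffAt (x := u))
  have hφ : ∀ x ∈ (chartAt E u.proj).source, MDifferentiableAt 𝓘(ℝ, E) 𝓘(ℝ, E) φ x :=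
    fun x hx ↦ mdifferentiableAt_extChartAt hx
  have hself : ∀ w : TangentSpace 𝓘(ℝ, E) u.proj, mvfderiv 𝓘(ℝ, E) φ u.proj w = w := fun w ↦
    congrArg (fun A : E →L[ℝ] E ↦ A w) (mfderiv_extChartAt_self (I := 𝓘(ℝ, E)) (x := u.proj))
  have hV := hX.vert
  have hbr := mvfderiv_mlieBracket (hf.of_le ENat.LEInfty.out) (hV.mdifferentiableAt hu)
    (hW.mdifferentiableAt hu)
  have h0 : (fun v ↦ mvfderiv 𝓘(ℝ, E).tangent f v (vert X v)) =ᶠ[𝓝 u] fun _ ↦ 0 := by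
    have hev : ∀ᶠ v : TM E M in 𝓝 u, v.proj ∈ (chartAt E u.proj).source :=
      (proj E M).contMDiff.continuous.continuousAt.eventually
        ((chartAt E u.proj).open_source.mem_nhds (mem_chart_source E u.proj))
    filter_upwards [hev] with v hv
    exact (mvfderiv_comp_proj (hφ _ hv) _).trans
      ((congrArg (mvfderiv 𝓘(ℝ, E) φ v.proj) (rho_gamma v (X v))).trans (map_zero _))
  have h0' : mvfderiv 𝓘(ℝ, E).tangent (fun v ↦ mvfderiv 𝓘(ℝ, E).tangent f v (vert X v)) u = 0 := by
    rw [mvfderiv, h0.mfderiv_eq]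
    exact mvfderiv_const (I := 𝓘(ℝ, E).tangent) (0 : E)
  have h1 := mvfderiv_gamma ((contMDiffAt_mvfderiv_apply (hW.contMDiffAt hu) hf).mdifferentiableAt
    (by simp)) (X u)
  -- All points of the fibre lie over the centre of the chart, where its derivative is the identity.
  have h2 : ∀ z : E, mvfderiv 𝓘(ℝ, E).tangent f (⟨u.1, z⟩ : TM E M) (W ⟨u.1, z⟩) =
      rho ⟨u.1, z⟩ (W ⟨u.1, z⟩) := by
    intro z
    exact (mvfderiv_comp_proj (v := (⟨u.1, z⟩ : TM E M)) (hφ _ (mem_chart_source E u.proj)) _).trans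
      (hself _)
  have h3 : mvfderiv 𝓘(ℝ, E).tangent f u (VectorField.mlieBracket 𝓘(ℝ, E).tangent (vert X) W u) =
      rho u (VectorField.mlieBracket 𝓘(ℝ, E).tangent (vert X) W u) := by
    exact (mvfderiv_comp_proj (hφ _ (mem_chart_source E u.proj)) _).trans (hself _)
  rw [h0', zero_apply, sub_zero] at hbr
  simp only [h2] at h1
  exact h3.symm.trans (hbr.trans h1)

end Fibre

/-! ### Higher derivatives and homogeneity on a vector space. -/

section Calculus

variable {E : Type*} [NormedAddCommGroup E] [NormedSpace ℝ E] {F : E → ℝ} {y : E}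

theorem fderiv_fderiv_apply {Z : E → E} (hF : DifferentiableAt ℝ (fderiv ℝ F) y)
    (hZ : DifferentiableAt ℝ Z y) (w : E) :
    fderiv ℝ (fun z ↦ fderiv ℝ F z (Z z)) y w =
      fderiv ℝ (fderiv ℝ F) y w (Z y) + fderiv ℝ F y (fderiv ℝ Z y w) := by
  rw [fderiv_clm_apply hF hZ]
  simp [add_comm]

theorem fderiv_fderiv_fderiv_apply {Y Z : E → E}
    (hF : DifferentiableAt ℝ (fderiv ℝ (fderiv ℝ F)) y)
    (hY : DifferentiableAt ℝ Y y) (hZ : DifferentiableAt ℝ Z y) (w : E) :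
    fderiv ℝ (fun z ↦ fderiv ℝ (fderiv ℝ F) z (Y z) (Z z)) y w =
      fderiv ℝ (fderiv ℝ (fderiv ℝ F)) y w (Y y) (Z y) +
        fderiv ℝ (fderiv ℝ F) y (fderiv ℝ Y y w) (Z y) +
        fderiv ℝ (fderiv ℝ F) y (Y y) (fderiv ℝ Z y w) := by
  rw [fderiv_clm_apply (hF.clm_apply hY) hZ, fderiv_clm_apply hF hY]
  simp
  ring

/-- The second derivative of a function homogeneous of degree `2` is homogeneous of degree `0`. -/
theorem fderiv_fderiv_smul_of_homogeneous
    (h : ∀ (w : E) (t : ℝ), 0 < t → F (t • w) = t ^ 2 * F w) (w : E) {t : ℝ} (ht : 0 < t) :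
    fderiv ℝ (fderiv ℝ F) (t • w) = fderiv ℝ (fderiv ℝ F) w := by
  have h1 : ∀ w, fderiv ℝ F (t • w) = t • fderiv ℝ F w := by
    intro w
    have h2 : (fun w ↦ F (t • w)) = t ^ 2 • F := funext fun w ↦ h w t ht
    have h3 := fderiv_comp_smul (f := F) (x := w) t
    rw [h2, fderiv_const_smul_field, pow_two, mul_smul] at h3
    exact (smul_right_injective _ ht.ne' h3).symm
  have h2 : (fun w ↦ fderiv ℝ F (t • w)) = t • fderiv ℝ F := funext h1
  have h3 := fderiv_comp_smul (f := fderiv ℝ F) (x := w) t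
  have h4 : fderiv ℝ (t • fderiv ℝ F) w = t • fderiv ℝ (fderiv ℝ F) w := by
    exact congrFun (fderiv_const_smul_field (𝕜 := ℝ) (F := E →L[ℝ] ℝ) (f := fderiv ℝ F) t) w
  rw [h2, h4] at h3
  exact (smul_right_injective _ ht.ne' h3).symm

/-- Euler's relation: the second derivative is constant along the ray `t • y`, `t > 0`, so its
radial derivative vanishes. -/
theorem fderiv_fderiv_fderiv_self_of_homogeneous
    (h : ∀ (w : E) (t : ℝ), 0 < t → F (t • w) = t ^ 2 * F w)
    (hF : DifferentiableAt ℝ (fderiv ℝ (fderiv ℝ F)) y) :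
    fderiv ℝ (fderiv ℝ (fderiv ℝ F)) y y = 0 := by
  have h1 : HasDerivAt (fun t : ℝ ↦ t • y) y 1 := by
    simpa using (hasDerivAt_id (1 : ℝ)).smul_const y
  have h2 : HasDerivAt (fun t : ℝ ↦ fderiv ℝ (fderiv ℝ F) (t • y))
      (fderiv ℝ (fderiv ℝ (fderiv ℝ F)) y y) 1 := by
    refine HasFDerivAt.comp_hasDerivAt (F := E) (f := fun t : ℝ ↦ t • y)
      (l := fderiv ℝ (fderiv ℝ F)) (1 : ℝ) ?_ h1
    rw [one_smul]
    exact hF.hasFDerivAt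
  have h3 : (fun t : ℝ ↦ fderiv ℝ (fderiv ℝ F) (t • y)) =ᶠ[𝓝 1]
      fun _ ↦ fderiv ℝ (fderiv ℝ F) y := by
    filter_upwards [lt_mem_nhds (zero_lt_one' ℝ)] with t ht using
      fderiv_fderiv_smul_of_homogeneous h y ht
  exact h2.unique ((hasDerivAt_const _ _).congr_of_eventuallyEq h3)

end Calculus

/-! ### The Finsler metric and the Cartan tensor. -/

section Metric

variable {E : Type*} [NormedAddCommGroup E] [NormedSpace ℝ E]
  {M : Type*} [TopologicalSpace M] [ChartedSpace E M] [IsManifold 𝓘(ℝ, E) ∞ M]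
  {L : TM E M → ℝ}

/-- The restriction of `L² / 2` to the fibre over `x`. -/
noncomputable def fibreEnergy (L : TM E M → ℝ) (x : M) (w : E) : ℝ := L ⟨x, w⟩ ^ 2 / 2

theorem contMDiffOn_energy (hL : IsFinsler L) :
    ContMDiffOn 𝓘(ℝ, E).tangent 𝓘(ℝ) ∞ (fun u ↦ L u ^ 2 / 2) (slit E M) := by
  have h : ContDiff ℝ ∞ (fun t : ℝ ↦ t ^ 2 / 2) := by fun_prop
  exact h.contMDiff.comp_contMDiffOn hL.contMDiffOn

theorem contDiffAt_fibreEnergy (hL : IsFinsler L) {x : M} {y : E}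
    (hy : (⟨x, y⟩ : TM E M) ∈ slit E M) : ContDiffAt ℝ ∞ (fibreEnergy L x) y :=
  contMDiffAt_iff_contDiffAt.1 (((contMDiffOn_energy hL).contMDiffAt (slit_mem_nhds hy)).comp y
    (contMDiff_fibre x).contMDiffAt)

/-- Twice the Cartan tensor: the third derivative of `L² / 2` along the fibres. -/
noncomputable def cubic (L : TM E M → ℝ) (u : TM E M) (a b c : PiBundle E M u) : ℝ :=
  fderiv ℝ (fderiv ℝ (fderiv ℝ (fibreEnergy L u.1))) (u.2 : E) a b c

theorem metric_comm (hL : IsFinsler L) {u : TM E M} (hu : u ∈ slit E M) (a b : PiBundle E M u) :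
    metric L u a b = metric L u b a :=
  ((contDiffAt_fibreEnergy hL hu).isSymmSndFDerivAt (n := ∞)
    (by rw [minSmoothness_of_isRCLikeNormedField]; exact ENat.LEInfty.out)).eq a b

theorem cubic_comm_left (hL : IsFinsler L) {u : TM E M} (hu : u ∈ slit E M)
    (a b c : PiBundle E M u) : cubic L u a b c = cubic L u b a c := by
  have h := ((contDiffAt_fibreEnergy hL hu).fderiv_right (m := ∞) (by simp)).isSymmSndFDerivAt
    (by rw [minSmoothness_of_isRCLikeNormedField]; exact ENat.LEInfty.out)
  exact congrArg (fun A : E →L[ℝ] ℝ ↦ A c) (h.eq a b)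

theorem differentiableAt_fderiv_fderiv_fibreEnergy (hL : IsFinsler L) {x : M} {y : E}
    (hy : (⟨x, y⟩ : TM E M) ∈ slit E M) :
    DifferentiableAt ℝ (fderiv ℝ (fderiv ℝ (fibreEnergy L x))) y :=
  (((contDiffAt_fibreEnergy hL hy).fderiv_right (m := ∞) (by simp)).fderiv_right (m := ∞)
    (by simp)).differentiableAt (by simp)

/-- The symmetry of `g` holds near `u` in the fibre and can be differentiated. Together with
`cubic_comm_left` it makes `C` totally symmetric. -/
theorem cubic_comm_right (hL : IsFinsler L) {u : TM E M} (hu : u ∈ slit E M)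
    (a b c : PiBundle E M u) : cubic L u a b c = cubic L u a c b := by
  have h : ∀ (x : M) (y a b c : E), (⟨x, y⟩ : TM E M) ∈ slit E M →
      fderiv ℝ (fderiv ℝ (fderiv ℝ (fibreEnergy L x))) y a b c =
        fderiv ℝ (fderiv ℝ (fderiv ℝ (fibreEnergy L x))) y a c b := by
    intro x y a b c hy
    have hd := differentiableAt_fderiv_fderiv_fibreEnergy hL hy
    have h1 : ∀ b c : E, fderiv ℝ (fun z ↦ fderiv ℝ (fderiv ℝ (fibreEnergy L x)) z b c) y a =
        fderiv ℝ (fderiv ℝ (fderiv ℝ (fibreEnergy L x))) y a b c := by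
      intro b c
      rw [fderiv_clm_apply (hd.clm_apply (differentiableAt_const b)) (differentiableAt_const c),
        fderiv_clm_apply hd (differentiableAt_const b)]
      simp
    rw [← h1, ← h1]
    congr 1
    refine Filter.EventuallyEq.fderiv_eq ?_
    filter_upwards [eventually_fibre_mem_slit hy] with z hz using metric_comm hL hz b c
  exact h u.1 u.2 a b c hu

theorem fibreEnergy_smul (hL : IsFinsler L) (x : M) (w : E) {t : ℝ} (ht : 0 < t) :
    fibreEnergy L x (t • w) = t ^ 2 * fibreEnergy L x w := by
  have := hL.homogeneous x w t ht
  simp only [fibreEnergy]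
  rw [show L (⟨x, t • w⟩ : TM E M) = t * L ⟨x, w⟩ from this]
  ring

/-- The Cartan tensor vanishes on the fundamental `π`-vector field. -/
theorem cubic_eta (hL : IsFinsler L) {u : TM E M} (hu : u ∈ slit E M)
    (b c : PiBundle E M u) : cubic L u (eta u) b c = 0 :=
  congrArg (fun A : E →L[ℝ] E →L[ℝ] ℝ ↦ A b c) (fderiv_fderiv_fderiv_self_of_homogeneous
    (fun w _ ht ↦ fibreEnergy_smul hL u.1 w ht)
    (differentiableAt_fderiv_fderiv_fibreEnergy hL hu))

theorem mvfderiv_vert_energy (hL : IsFinsler L) {u : TM E M} (hu : u ∈ slit E M)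
    (w : PiBundle E M u) :
    mvfderiv 𝓘(ℝ, E).tangent (fun u ↦ L u ^ 2 / 2) u (gamma u w) =
      fderiv ℝ (fibreEnergy L u.1) (u.2 : E) w :=
  mvfderiv_gamma (((contMDiffOn_energy hL).contMDiffAt (slit_mem_nhds hu)).mdifferentiableAt
    (by simp)) w

/-- The Hessian of `F` is `Y(Z F) - (∂_Y Z) F`. Written with vector fields on `TM`, it shows that
`g(Y, Z)` is smooth on the slit bundle and not only along each fibre. -/
theorem metric_eq_mvfderiv (hL : IsFinsler L) {Y Z : PiField E M} (hZ : IsPiVectorField Z)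
    {u : TM E M} (hu : u ∈ slit E M) :
    metric L u (Y u) (Z u) = mvfderiv 𝓘(ℝ, E).tangent
      (fun v ↦ mvfderiv 𝓘(ℝ, E).tangent (fun u ↦ L u ^ 2 / 2) v (vert Z v)) u (vert Y u) -
      mvfderiv 𝓘(ℝ, E).tangent (fun u ↦ L u ^ 2 / 2) u (gamma u (fibreDeriv Z u (Y u))) := by
  have h1 := mvfderiv_gamma ((contMDiffAt_mvfderiv_apply (hZ.vert.contMDiffAt hu)
    ((contMDiffOn_energy hL).contMDiffAt (slit_mem_nhds hu))).mdifferentiableAt (by simp)) (Y u)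
  have h2 : ∀ (x : M) (y w : E), (⟨x, y⟩ : TM E M) ∈ slit E M →
      fderiv ℝ (fun z : E ↦ mvfderiv 𝓘(ℝ, E).tangent (fun u : TM E M ↦ L u ^ 2 / 2)
        (⟨x, z⟩ : TM E M) (vert Z (⟨x, z⟩ : TM E M))) y w =
      fderiv ℝ (fun z : E ↦ fderiv ℝ (fibreEnergy L x) z (Z (⟨x, z⟩ : TM E M))) y w := by
    intro x y w hy
    refine congrArg (fun A : E →L[ℝ] ℝ ↦ A w) (Filter.EventuallyEq.fderiv_eq ?_)
    filter_upwards [eventually_fibre_mem_slit hy] with z hz using mvfderiv_vert_energy hL hz _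
  have h3 := fderiv_fderiv_apply (((contDiffAt_fibreEnergy hL hu).fderiv_right (m := ∞)
    (by simp)).differentiableAt (by simp)) ((hZ.contDiffAt_fibre hu).differentiableAt (by simp))
    (Y u)
  have h4 := h1.trans ((h2 u.1 u.2 (Y u) hu).trans h3)
  exact eq_sub_of_add_eq (h4.trans (congrArg₂ (· + ·) rfl
    (mvfderiv_vert_energy hL hu (fibreDeriv Z u (Y u))).symm)).symm

/-- The derivative of the Finsler metric along the fibres. -/
theorem mvfderiv_vert_metric (hL : IsFinsler L) {X Y Z : PiField E M}
    (hY : IsPiVectorField Y) (hZ : IsPiVectorField Z) {u : TM E M} (hu : u ∈ slit E M)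
    (hd : MDifferentiableAt 𝓘(ℝ, E).tangent 𝓘(ℝ) (fun v ↦ metric L v (Y v) (Z v)) u) :
    mvfderiv 𝓘(ℝ, E).tangent (fun v ↦ metric L v (Y v) (Z v)) u (vert X u) =
      cubic L u (X u) (Y u) (Z u) + metric L u (fibreDeriv Y u (X u)) (Z u)
        + metric L u (Y u) (fibreDeriv Z u (X u)) :=
  (mvfderiv_gamma hd (X u)).trans (fderiv_fderiv_fderiv_apply
    (differentiableAt_fderiv_fderiv_fibreEnergy hL hu)
    ((hY.contDiffAt_fibre hu).differentiableAt (by simp))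
    ((hZ.contDiffAt_fibre hu).differentiableAt (by simp)) (X u))

end Metric

/-! ### Locality, additivity and smoothness of torsion and curvature. -/

section Connection

variable {E : Type*} [NormedAddCommGroup E] [NormedSpace ℝ E]
  {M : Type*} [TopologicalSpace M] [ChartedSpace E M] [IsManifold 𝓘(ℝ, E) ∞ M]
  {D : ConnOp E M} {u : TM E M}

theorem conn_congr (hD : IsLinearConnection D) {Y Z : PiField E M} (hY : IsPiVectorField Y)
    (h : ∀ v ∈ slit E M, Z v = Y v) (hu : u ∈ slit E M) : D Z u = D Y u :=
  hD.isCovariantDerivativeOn.congr_of_eqOn ((hY.congr h).mdifferentiableAt hu)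
    (hY.mdifferentiableAt hu) (slit_mem_nhds hu) h

theorem conn_add (hD : IsLinearConnection D) {Y Z : PiField E M} (hY : IsPiVectorField Y)
    (hZ : IsPiVectorField Z) (hu : u ∈ slit E M) : D (Y + Z) u = D Y u + D Z u :=
  hD.isCovariantDerivativeOn.add (hY.mdifferentiableAt hu) (hZ.mdifferentiableAt hu) hu

theorem isPiVectorField_zero : IsPiVectorField (0 : PiField E M) := by
  have h := (isPiVectorField_eta (E := E) (M := M)).sub isPiVectorField_eta
  rwa [sub_self] at h

theorem conn_eq_zero (hD : IsLinearConnection D) {Z : PiField E M}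
    (h : ∀ v ∈ slit E M, Z v = 0) (hu : u ∈ slit E M) : D Z u = 0 :=
  (conn_congr hD isPiVectorField_zero h hu).trans (hD.isCovariantDerivativeOn.zero hu)

theorem conn_sub (hD : IsLinearConnection D) {Y Z : PiField E M} (hY : IsPiVectorField Y)
    (hZ : IsPiVectorField Z) (hu : u ∈ slit E M) : D (Y - Z) u = D Y u - D Z u := by
  have h := conn_add hD (hY.sub hZ) hZ hu
  rw [sub_add_cancel] at h
  exact eq_sub_of_add_eq h.symm

theorem conn_smul (hD : IsLinearConnection D) {f : TM E M → ℝ} {Z : PiField E M}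
    (hf : ContMDiffOn 𝓘(ℝ, E).tangent 𝓘(ℝ) ∞ f (slit E M)) (hZ : IsPiVectorField Z)
    (hu : u ∈ slit E M) (V : TangentSpace 𝓘(ℝ, E).tangent u) :
    D (f • Z) u V = f u • D Z u V + mvfderiv 𝓘(ℝ, E).tangent f u V • Z u := by
  have h := hD.isCovariantDerivativeOn.leibniz (hZ.mdifferentiableAt hu)
    ((hf.contMDiffAt (slit_mem_nhds hu)).mdifferentiableAt (by simp)) hu
  rw [h]
  rfl

theorem IsTVectorField.add {V W : TField E M} (hV : IsTVectorField V) (hW : IsTVectorField W) :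
    IsTVectorField (V + W) :=
  ContMDiffOn.add_section hV hW

theorem torsion_swap (V W : TField E M) : torsion D W V u = -torsion D V W u := by
  simp only [torsion]
  rw [VectorField.mlieBracket_swap_apply, map_neg]
  abel

/-- Locality and additivity (`torsion_add_right`) are enough to insert the splitting into horizontal
and vertical fields; tensoriality over functions is not needed. -/
theorem torsion_congr_right (hD : IsLinearConnection D) {V W W' : TField E M}
    (hW : IsTVectorField W) (h : ∀ v ∈ slit E M, W' v = W v) (hu : u ∈ slit E M) :
    torsion D V W' u = torsion D V W u := by
  have h1 : VectorField.mlieBracket 𝓘(ℝ, E).tangent V W' u =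
      VectorField.mlieBracket 𝓘(ℝ, E).tangent V W u :=
    Filter.EventuallyEq.mlieBracket_vectorField_eq Filter.EventuallyEq.rfl
      (Filter.eventuallyEq_of_mem (slit_mem_nhds hu) h)
  have h2 : D (fun v ↦ rho v (W' v)) u = D (fun v ↦ rho v (W v)) u :=
    conn_congr hD hW.rho (fun v hv ↦ by rw [h v hv]) hu
  simp only [torsion]
  rw [h1, h2, h u hu]

theorem torsion_add_right [CompleteSpace E] (hD : IsLinearConnection D) {V W W' : TField E M}
    (hW : IsTVectorField W) (hW' : IsTVectorField W') (hu : u ∈ slit E M) :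
    torsion D V (W + W') u = torsion D V W u + torsion D V W' u := by
  have h1 : VectorField.mlieBracket 𝓘(ℝ, E).tangent V (W + W') u =
      VectorField.mlieBracket 𝓘(ℝ, E).tangent V W u +
      VectorField.mlieBracket 𝓘(ℝ, E).tangent V W' u :=
    VectorField.mlieBracket_add_right (hW.mdifferentiableAt hu) (hW'.mdifferentiableAt hu)
  have h2 : D (fun v ↦ rho v ((W + W') v)) u =
      D (fun v ↦ rho v (W v)) u + D (fun v ↦ rho v (W' v)) u := by
    rw [← conn_add hD hW.rho hW'.rho hu]
    congr 1
    funext v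
    exact map_add _ _ _
  simp only [torsion]
  rw [h1, h2, map_add, Pi.add_apply, map_add, add_apply]
  abel

theorem isPiVectorField_torsion [CompleteSpace E] (hD : IsLinearConnection D) {V W : TField E M}
    (hV : IsTVectorField V) (hW : IsTVectorField W) : IsPiVectorField (torsion D V W) :=
  ((contMDiffOn_conn hD hW.rho hV).sub (contMDiffOn_conn hD hV.rho hW)).sub (hV.mlieBracket hW).rho

theorem isPiVectorField_curvature [CompleteSpace E] (hD : IsLinearConnection D) {V W : TField E M}
    {Z : PiField E M} (hV : IsTVectorField V) (hW : IsTVectorField W) (hZ : IsPiVectorField Z) :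
    IsPiVectorField (curvature D V W Z) :=
  ((contMDiffOn_conn hD (contMDiffOn_conn hD hZ hW) hV).neg.add
    (contMDiffOn_conn hD (contMDiffOn_conn hD hZ hV) hW)).add
    (contMDiffOn_conn hD hZ (hV.mlieBracket hW))

theorem torsion_vert_vert [CompleteSpace E] (hD : IsLinearConnection D)
    {X Y : PiField E M} (hX : IsPiVectorField X) (hY : IsPiVectorField Y) (hu : u ∈ slit E M) :
    torsion D (vert X) (vert Y) u = 0 := by
  have h1 : D (fun v ↦ rho v (vert Y v)) u = 0 :=
    conn_eq_zero hD (fun v _ ↦ rho_gamma v _) hu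
  have h2 : D (fun v ↦ rho v (vert X v)) u = 0 :=
    conn_eq_zero hD (fun v _ ↦ rho_gamma v _) hu
  have h3 : rho u (VectorField.mlieBracket 𝓘(ℝ, E).tangent (vert X) (vert Y) u) = 0 := by
    have h4 : ∀ y w : E, fderiv ℝ (fun _ : E ↦ (0 : E)) y w = 0 := by simp
    exact (rho_mlieBracket_vert hX hY.vert hu).trans
      ((fibreDeriv_congr (Z := 0) (fun v _ ↦ rho_gamma v _) hu _).trans (h4 u.2 (X u)))
  simp only [torsion]
  rw [h1, h2, h3, zero_apply, zero_apply, sub_zero, sub_zero]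

variable [FiniteDimensional ℝ E] [CompleteSpace E]

theorem rho_mlieBracket_vert_horiz (hD : IsLinearConnection D) (hR : IsRegular D)
    {X Y : PiField E M} (hX : IsPiVectorField X) (hY : IsPiVectorField Y) (hu : u ∈ slit E M) :
    rho u (VectorField.mlieBracket 𝓘(ℝ, E).tangent (vert X) (horiz D Y) u) =
      fibreDeriv Y u (X u) :=
  (rho_mlieBracket_vert hX (hY.isTVectorField_horiz hD hR) hu).trans
    (fibreDeriv_congr (fun _ hv ↦ hR.rho_beta hv _) hu _)

/-- The fibre derivative is `ρ[γX, βY]`, and brackets of smooth fields are smooth. -/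
theorem isPiVectorField_fibreDeriv (hD : IsLinearConnection D) (hR : IsRegular D)
    {X Y : PiField E M} (hX : IsPiVectorField X) (hY : IsPiVectorField Y) :
    IsPiVectorField fun v ↦ fibreDeriv Y v (X v) :=
  (hX.vert.mlieBracket (hY.isTVectorField_horiz hD hR)).rho.congr fun _ hv ↦
    (rho_mlieBracket_vert_horiz hD hR hX hY hv).symm

/-- `T` measures the difference between `D` and the flat derivative along the fibres, since `ργX =
0` and `ρ[γX, βY]` is that flat derivative. -/
theorem torsionT_apply (hD : IsLinearConnection D) (hR : IsRegular D)
    {X Y : PiField E M} (hX : IsPiVectorField X) (hY : IsPiVectorField Y) (hu : u ∈ slit E M) :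
    torsionT D X Y u = D Y u (vert X u) - fibreDeriv Y u (X u) := by
  have h1 : D (fun v ↦ rho v (horiz D Y v)) u = D Y u :=
    conn_congr hD hY (fun v hv ↦ hR.rho_beta hv _) hu
  have h2 : D (fun v ↦ rho v (vert X v)) u = 0 :=
    conn_eq_zero hD (fun v _ ↦ rho_gamma v _) hu
  simp only [torsionT, torsion]
  rw [h1, h2, rho_mlieBracket_vert_horiz hD hR hX hY hu, zero_apply, sub_zero]

theorem isPiVectorField_torsionT (hD : IsLinearConnection D) (hR : IsRegular D)
    {X Y : PiField E M} (hX : IsPiVectorField X) (hY : IsPiVectorField Y) :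
    IsPiVectorField (torsionT D X Y) :=
  isPiVectorField_torsion hD hX.vert (hY.isTVectorField_horiz hD hR)

theorem isPiVectorField_curvP (hD : IsLinearConnection D) (hR : IsRegular D)
    {X Y Z : PiField E M} (hX : IsPiVectorField X) (hY : IsPiVectorField Y)
    (hZ : IsPiVectorField Z) : IsPiVectorField (curvP D X Y Z) :=
  isPiVectorField_curvature hD (hX.isTVectorField_horiz hD hR) hY.vert hZ

end Connection

/-! ### First properties of the Cartan connection. -/

section Cartan

variable {E : Type*} [NormedAddCommGroup E] [NormedSpace ℝ E]
  {M : Type*} [TopologicalSpace M] [ChartedSpace E M] [IsManifold 𝓘(ℝ, E) ∞ M]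
  {L : TM E M → ℝ} {D : ConnOp E M} {u : TM E M}

/-- Testing against the field `A - B` itself suffices, so no vector has to be extended to a smooth
section. -/
theorem eq_of_metric (hL : IsFinsler L) {A B : PiField E M} (hA : IsPiVectorField A)
    (hB : IsPiVectorField B) (hu : u ∈ slit E M)
    (h : ∀ W : PiField E M, IsPiVectorField W → metric L u (A u) (W u) = metric L u (B u) (W u)) :
    A u = B u := by
  by_contra hne
  refine (hL.posDef u hu (A u - B u) (sub_ne_zero.2 hne)).ne' ?_
  have h1 := h (A - B) (hA.sub hB)
  rw [map_sub (metric L u), sub_apply]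
  exact sub_eq_zero.2 h1

theorem eq_zero_of_metric (hL : IsFinsler L) {A : PiField E M} (hA : IsPiVectorField A)
    (hu : u ∈ slit E M)
    (h : ∀ W : PiField E M, IsPiVectorField W → metric L u (A u) (W u) = 0) : A u = 0 :=
  eq_of_metric hL (B := 0) hA isPiVectorField_zero hu fun W hW ↦ by
    rw [h W hW, Pi.zero_apply, map_zero, zero_apply]

theorem mvfderiv_metric (hD : IsCartanConnection L D) {Y Z : PiField E M}
    (hY : IsPiVectorField Y) (hZ : IsPiVectorField Z) (hu : u ∈ slit E M)
    (V : TangentSpace 𝓘(ℝ, E).tangent u) :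
    mvfderiv 𝓘(ℝ, E).tangent (fun v ↦ metric L v (Y v) (Z v)) u V =
      metric L u (D Y u V) (Z u) + metric L u (Y u) (D Z u V) :=
  hD.metric_compat Y Z hY hZ u hu V

variable [FiniteDimensional ℝ E] [CompleteSpace E]

theorem contMDiffOn_metric (hL : IsFinsler L) (hD : IsCartanConnection L D) {Y Z : PiField E M}
    (hY : IsPiVectorField Y) (hZ : IsPiVectorField Z) :
    ContMDiffOn 𝓘(ℝ, E).tangent 𝓘(ℝ) ∞ (fun v ↦ metric L v (Y v) (Z v)) (slit E M) :=
  ((hY.vert.mvfderiv (hZ.vert.mvfderiv (contMDiffOn_energy hL))).sub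
    ((isPiVectorField_fibreDeriv hD.isLinearConnection hD.isRegular hY hZ).vert.mvfderiv
      (contMDiffOn_energy hL))).congr fun _ hv ↦ metric_eq_mvfderiv hL hZ hv

theorem mdifferentiableAt_metric (hL : IsFinsler L) (hD : IsCartanConnection L D)
    {Y Z : PiField E M} (hY : IsPiVectorField Y) (hZ : IsPiVectorField Z) (hu : u ∈ slit E M) :
    MDifferentiableAt 𝓘(ℝ, E).tangent 𝓘(ℝ) (fun v ↦ metric L v (Y v) (Z v)) u :=
  ((contMDiffOn_metric hL hD hY hZ).contMDiffAt (slit_mem_nhds hu)).mdifferentiableAt (by simp)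

/-- The `(h)hv`-torsion of the Cartan connection is the Cartan tensor. -/
theorem metric_torsionT (hL : IsFinsler L) (hD : IsCartanConnection L D) {X Y Z : PiField E M}
    (hX : IsPiVectorField X) (hY : IsPiVectorField Y) (hZ : IsPiVectorField Z)
    (hu : u ∈ slit E M) :
    2 * metric L u (torsionT D X Y u) (Z u) = cubic L u (X u) (Y u) (Z u) := by
  -- Comparing the flat and the covariant expression of `γX(g(Y, Z))` gives `C(X, Y, Z) = g(T(X, Y),
  -- Z) + g(Y, T(X, Z))`; by the symmetry of `T` the two terms are equal.
  have h1 := mvfderiv_vert_metric (X := X) hL hY hZ hu (mdifferentiableAt_metric hL hD hY hZ hu)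
  have h2 := hD.metric_compat Y Z hY hZ u hu (vert X u)
  have h3 := hD.torsionT_symm X Y Z hX hY hZ u hu
  have h4 := metric_comm hL hu (torsionT D X Z u) (Y u)
  rw [torsionT_apply hD.isLinearConnection hD.isRegular hX hZ hu] at h3 h4
  rw [torsionT_apply hD.isLinearConnection hD.isRegular hX hY hu] at h3 ⊢
  simp only [map_sub, sub_apply] at h3 h4 ⊢
  linarith

theorem torsionT_eta (hL : IsFinsler L) (hD : IsCartanConnection L D) {X : PiField E M}
    (hX : IsPiVectorField X) (hu : u ∈ slit E M) : torsionT D X eta u = 0 := by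
  refine eq_zero_of_metric hL (isPiVectorField_torsionT hD.isLinearConnection hD.isRegular hX
    isPiVectorField_eta) hu fun W hW ↦ ?_
  have h := metric_torsionT hL hD hX isPiVectorField_eta hW hu
  rw [cubic_comm_left hL hu, cubic_eta hL hu] at h
  linarith

/-- Because `T(X, η) = 0`, `D_{γX} η` is the flat derivative of `η`, the identity of the fibre. So
`K` inverts `γ`. -/
theorem connMap_vert (hL : IsFinsler L) (hD : IsCartanConnection L D) {X : PiField E M}
    (hX : IsPiVectorField X) (hu : u ∈ slit E M) : connMap D u (vert X u) = X u := by
  have h1 := torsionT_apply hD.isLinearConnection hD.isRegular hX isPiVectorField_eta hu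
  rw [torsionT_eta hL hD hX hu, fibreDeriv_eta] at h1
  exact sub_eq_zero.1 h1.symm

/-- The decomposition of a vector field into its horizontal and its vertical part. -/
theorem eq_horiz_add_vert (hL : IsFinsler L) (hD : IsCartanConnection L D) {V : TField E M}
    (hV : IsTVectorField V) (hu : u ∈ slit E M) :
    V u = (horiz D (fun v ↦ rho v (V v)) + vert (fun v ↦ connMap D v (V v))) u := by
  have hK : IsPiVectorField fun v ↦ connMap D v (V v) :=
    contMDiffOn_conn hD.isLinearConnection isPiVectorField_eta hV
  have h1 := connMap_vert hL hD hK hu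
  refine sub_eq_zero.1 (hD.isRegular.eq_zero hu ?_ ?_)
  · have h2 : rho u (horiz D (fun v ↦ rho v (V v)) u) = rho u (V u) := hD.isRegular.rho_beta hu _
    have h3 : rho u (vert (fun v ↦ connMap D v (V v)) u) = 0 := rho_gamma u _
    rw [Pi.add_apply, map_sub, map_add, h2, h3, add_zero, sub_self]
  · have h2 : connMap D u (horiz D (fun v ↦ rho v (V v)) u) = 0 := connMap_beta u _
    rw [Pi.add_apply, map_sub, map_add, h2, h1, zero_add, sub_self]

/-- The torsion of the Cartan connection along a horizontal vector field. -/
theorem torsion_horiz (hL : IsFinsler L) (hD : IsCartanConnection L D) {X : PiField E M}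
    (hX : IsPiVectorField X) {V : TField E M} (hV : IsTVectorField V) (hu : u ∈ slit E M) :
    torsion D (horiz D X) V u = -torsionT D (fun v ↦ connMap D v (V v)) X u := by
  have hK : IsPiVectorField fun v ↦ connMap D v (V v) :=
    contMDiffOn_conn hD.isLinearConnection isPiVectorField_eta hV
  have hH := hV.rho.isTVectorField_horiz hD.isLinearConnection hD.isRegular
  rw [torsion_congr_right hD.isLinearConnection (hH.add hK.vert)
      (fun v hv ↦ eq_horiz_add_vert hL hD hV hv) hu,
    torsion_add_right hD.isLinearConnection hH hK.vert hu]
  have h1 : torsion D (horiz D X) (horiz D fun v ↦ rho v (V v)) u = 0 :=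
    hD.torsionQ_eq_zero X _ hX hV.rho u hu
  rw [h1, zero_add, torsion_swap]
  rfl

/-- The torsion of the Cartan connection along a vertical vector field. -/
theorem torsion_vert (hL : IsFinsler L) (hD : IsCartanConnection L D) {Y : PiField E M}
    (hY : IsPiVectorField Y) {V : TField E M} (hV : IsTVectorField V) (hu : u ∈ slit E M) :
    torsion D (vert Y) V u = torsionT D Y (fun v ↦ rho v (V v)) u := by
  have hK : IsPiVectorField fun v ↦ connMap D v (V v) :=
    contMDiffOn_conn hD.isLinearConnection isPiVectorField_eta hV
  have hH := hV.rho.isTVectorField_horiz hD.isLinearConnection hD.isRegular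
  rw [torsion_congr_right hD.isLinearConnection (hH.add hK.vert)
      (fun v hv ↦ eq_horiz_add_vert hL hD hV hv) hu,
    torsion_add_right hD.isLinearConnection hH hK.vert hu,
    torsion_vert_vert hD.isLinearConnection hY hK hu, add_zero]
  rfl

theorem mvfderiv_mvfderiv_metric (hL : IsFinsler L) (hD : IsCartanConnection L D)
    {Y Z : PiField E M} (hY : IsPiVectorField Y) (hZ : IsPiVectorField Z) {V W : TField E M}
    (hW : IsTVectorField W) (hu : u ∈ slit E M) :
    mvfderiv 𝓘(ℝ, E).tangent (fun v ↦ mvfderiv 𝓘(ℝ, E).tangent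
        (fun v ↦ metric L v (Y v) (Z v)) v (W v)) u (V u) =
      metric L u (D (fun v ↦ D Y v (W v)) u (V u)) (Z u) +
      metric L u (D Y u (W u)) (D Z u (V u)) + (metric L u (D Y u (V u)) (D Z u (W u)) +
      metric L u (Y u) (D (fun v ↦ D Z v (W v)) u (V u))) := by
  have hWY := contMDiffOn_conn hD.isLinearConnection hY hW
  have hWZ := contMDiffOn_conn hD.isLinearConnection hZ hW
  have h1 : (fun v ↦ mvfderiv 𝓘(ℝ, E).tangent (fun v ↦ metric L v (Y v) (Z v)) v (W v)) =ᶠ[𝓝 u]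
      (fun v ↦ metric L v (D Y v (W v)) (Z v)) + fun v ↦ metric L v (Y v) (D Z v (W v)) := by
    filter_upwards [slit_mem_nhds hu] with v hv using hD.metric_compat Y Z hY hZ v hv (W v)
  have h2 := congrArg (fun A ↦ A (V u))
    (mvfderiv_add (mdifferentiableAt_metric hL hD hWY hZ hu)
      (mdifferentiableAt_metric hL hD hY hWZ hu))
  have h3 := mvfderiv_metric hD hWY hZ hu (V u)
  have h4 := mvfderiv_metric hD hY hWZ hu (V u)
  rw [mvfderiv, h1.mfderiv_eq]
  refine h2.trans ?_
  exact congrArg₂ (· + ·) h3 h4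

/-- The curvature of a metric connection is skew-symmetric. -/
theorem metric_curvature (hL : IsFinsler L) (hD : IsCartanConnection L D)
    {Y Z : PiField E M} (hY : IsPiVectorField Y) (hZ : IsPiVectorField Z) {V W : TField E M}
    (hV : IsTVectorField V) (hW : IsTVectorField W) (hu : u ∈ slit E M) :
    metric L u (curvature D V W Y u) (Z u) = -metric L u (Y u) (curvature D V W Z u) := by
  -- The commutator of `V` and `W` acting on the function `g(Y, Z)` is expanded with `D g = 0`; the
  -- mixed products `g(D_V Y, D_W Z)` cancel.
  have h1 := mvfderiv_mlieBracket (((contMDiffOn_metric hL hD hY hZ).contMDiffAt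
    (slit_mem_nhds hu)).of_le ENat.LEInfty.out) (hV.mdifferentiableAt hu) (hW.mdifferentiableAt hu)
  rw [mvfderiv_metric hD hY hZ hu, mvfderiv_mvfderiv_metric hL hD hY hZ hW hu,
    mvfderiv_mvfderiv_metric hL hD hY hZ hV hu] at h1
  simp only [curvature, map_add, map_neg, add_apply, neg_apply]
  linarith

end Cartan

/-! ### Multilinearity of the Cartan tensor. -/

section Cubic

variable {E : Type*} [NormedAddCommGroup E] [NormedSpace ℝ E]
  {M : Type*} [TopologicalSpace M] [ChartedSpace E M] [IsManifold 𝓘(ℝ, E) ∞ M]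
  {L : TM E M → ℝ} {u : TM E M}

theorem cubic_add (a b c c' : PiBundle E M u) :
    cubic L u a b (c + c') = cubic L u a b c + cubic L u a b c' :=
  map_add (fderiv ℝ (fderiv ℝ (fderiv ℝ (fibreEnergy L u.1))) (u.2 : E) a b) (c : E) c'

theorem cubic_smul (a b : PiBundle E M u) (t : ℝ) (c : PiBundle E M u) :
    cubic L u a b (t • c) = t * cubic L u a b c :=
  map_smul (fderiv ℝ (fderiv ℝ (fderiv ℝ (fibreEnergy L u.1))) (u.2 : E) a b) t (c : E)

theorem cubic_zero (a b : PiBundle E M u) : cubic L u a b 0 = 0 :=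
  map_zero (fderiv ℝ (fderiv ℝ (fderiv ℝ (fibreEnergy L u.1))) (u.2 : E) a b)

theorem cubic_add_left (hL : IsFinsler L) (hu : u ∈ slit E M) (a a' b c : PiBundle E M u) :
    cubic L u (a + a') b c = cubic L u a b c + cubic L u a' b c := by
  simp only [fun a ↦ (cubic_comm_left hL hu a b c).trans (cubic_comm_right hL hu b a c), cubic_add]

theorem cubic_sub_middle (hL : IsFinsler L) (hu : u ∈ slit E M) (a b b' c : PiBundle E M u) :
    cubic L u a (b - b') c = cubic L u a b c - cubic L u a b' c := by
  have h := cubic_add (L := L) a c (b - b') b'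
  rw [sub_add_cancel] at h
  simp only [fun b ↦ cubic_comm_right hL hu a b c]
  linarith

end Cubic

/-! ### The hv-curvature through the Cartan tensor. -/

section HVCurvature

variable {E : Type*} [NormedAddCommGroup E] [NormedSpace ℝ E]
  {M : Type*} [TopologicalSpace M] [ChartedSpace E M] [IsManifold 𝓘(ℝ, E) ∞ M]
  {L : TM E M → ℝ} {D : ConnOp E M} {u : TM E M}

/-- The covariant derivative `(D_{βA} C)(X, Y, Z)` of `C = cubic L`. -/
noncomputable def nablaCubic (L : TM E M → ℝ) (D : ConnOp E M) (A X Y Z : PiField E M)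
    (u : TM E M) : ℝ :=
  mvfderiv 𝓘(ℝ, E).tangent (fun v ↦ cubic L v (X v) (Y v) (Z v)) u (horiz D A u)
    - cubic L u (D X u (horiz D A u)) (Y u) (Z u)
    - cubic L u (X u) (D Y u (horiz D A u)) (Z u)
    - cubic L u (X u) (Y u) (D Z u (horiz D A u))

theorem mvfderiv_cubic_congr {X Y Z X' Y' Z' : PiField E M}
    (h : ∀ v ∈ slit E M, cubic L v (X v) (Y v) (Z v) = cubic L v (X' v) (Y' v) (Z' v))
    (hu : u ∈ slit E M) :
    mvfderiv 𝓘(ℝ, E).tangent (fun v ↦ cubic L v (X v) (Y v) (Z v)) u =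
      mvfderiv 𝓘(ℝ, E).tangent (fun v ↦ cubic L v (X' v) (Y' v) (Z' v)) u := by
  have h1 : (fun v ↦ cubic L v (X v) (Y v) (Z v)) =ᶠ[𝓝 u]
      fun v ↦ cubic L v (X' v) (Y' v) (Z' v) := Filter.eventuallyEq_of_mem (slit_mem_nhds hu) h
  rw [mvfderiv, h1.mfderiv_eq]
  rfl

theorem nablaCubic_comm_left (hL : IsFinsler L) (A X Y Z : PiField E M) (hu : u ∈ slit E M) :
    nablaCubic L D A X Y Z u = nablaCubic L D A Y X Z u := by
  simp only [nablaCubic]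
  rw [mvfderiv_cubic_congr (X' := Y) (Y' := X) (Z' := Z)
      (fun v hv ↦ cubic_comm_left hL hv _ _ _) hu,
    cubic_comm_left hL hu (D X u _), cubic_comm_left hL hu (X u) (D Y u _),
    cubic_comm_left hL hu (X u) (Y u)]
  ring

theorem nablaCubic_comm_right (hL : IsFinsler L) (A X Y Z : PiField E M) (hu : u ∈ slit E M) :
    nablaCubic L D A X Y Z u = nablaCubic L D A X Z Y u := by
  simp only [nablaCubic]
  rw [mvfderiv_cubic_congr (X' := X) (Y' := Z) (Z' := Y)
      (fun v hv ↦ cubic_comm_right hL hv _ _ _) hu,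
    cubic_comm_right hL hu (D X u _), cubic_comm_right hL hu (X u) (D Y u _),
    cubic_comm_right hL hu (X u) (Y u) (D Z u _)]
  ring

/-- `Z` annihilates the Cartan tensor. -/
def IsCubicNull (L : TM E M → ℝ) (Z : PiField E M) : Prop :=
  ∀ X Y : PiField E M, IsPiVectorField X → IsPiVectorField Y → ∀ u ∈ slit E M,
    cubic L u (X u) (Y u) (Z u) = 0

theorem isCubicNull_eta (hL : IsFinsler L) : IsCubicNull L (eta : PiField E M) :=
  fun X Y _ _ u hu ↦ by
    rw [cubic_comm_right hL hu, cubic_comm_left hL hu, cubic_eta hL hu]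

variable [FiniteDimensional ℝ E]

theorem IsPiVectorField.conn_horiz (hD : IsCartanConnection L D) {A Z : PiField E M}
    (hA : IsPiVectorField A) (hZ : IsPiVectorField Z) :
    IsPiVectorField fun v ↦ D Z v (horiz D A v) :=
  contMDiffOn_conn hD.isLinearConnection hZ
    (hA.isTVectorField_horiz hD.isLinearConnection hD.isRegular)

theorem rho_mlieBracket_horiz_horiz (hD : IsCartanConnection L D)
    {X Y : PiField E M} (hX : IsPiVectorField X) (hY : IsPiVectorField Y) (hu : u ∈ slit E M) :
    rho u (VectorField.mlieBracket 𝓘(ℝ, E).tangent (horiz D X) (horiz D Y) u) =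
      D Y u (horiz D X u) - D X u (horiz D Y u) := by
  have h := hD.torsionQ_eq_zero X Y hX hY u hu
  have h1 : D (fun v ↦ rho v (horiz D X v)) u = D X u :=
    conn_congr hD.isLinearConnection hX (fun v hv ↦ hD.isRegular.rho_beta hv _) hu
  have h2 : D (fun v ↦ rho v (horiz D Y v)) u = D Y u :=
    conn_congr hD.isLinearConnection hY (fun v hv ↦ hD.isRegular.rho_beta hv _) hu
  simp only [torsionQ, torsion] at h
  rw [h1, h2] at h
  exact (sub_eq_zero.1 h).symm

/-- In the Leibniz rule for `C(X, Y, Z) = 0` only the term differentiating `Z` survives, the others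
still having `Z` as an argument. -/
theorem IsCubicNull.nablaCubic (hD : IsCartanConnection L D) {A X Y Z : PiField E M}
    (h : IsCubicNull L Z) (hA : IsPiVectorField A) (hX : IsPiVectorField X)
    (hY : IsPiVectorField Y) (hu : u ∈ slit E M) :
    nablaCubic L D A X Y Z u = -cubic L u (X u) (Y u) (D Z u (horiz D A u)) := by
  have h1 : (fun v ↦ cubic L v (X v) (Y v) (Z v)) =ᶠ[𝓝 u] fun _ ↦ (0 : ℝ) :=
    Filter.eventuallyEq_of_mem (slit_mem_nhds hu) (h X Y hX hY)
  have h2 : mvfderiv 𝓘(ℝ, E).tangent (fun v ↦ cubic L v (X v) (Y v) (Z v)) u = 0 := by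
    rw [mvfderiv, h1.mfderiv_eq]
    exact mvfderiv_const (I := 𝓘(ℝ, E).tangent) (0 : ℝ)
  rw [PiFinsler.nablaCubic, h2, zero_apply, h _ _ (hA.conn_horiz hD hX) hY u hu,
    h _ _ hX (hA.conn_horiz hD hY) u hu]
  ring

variable [CompleteSpace E]

/-- The derivative of the Cartan tensor in terms of that of the `(h)hv`-torsion. -/
theorem mvfderiv_cubic (hL : IsFinsler L) (hD : IsCartanConnection L D) {X Y Z : PiField E M}
    {V : TField E M} (hX : IsPiVectorField X) (hY : IsPiVectorField Y) (hZ : IsPiVectorField Z)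
    (hV : IsTVectorField V) (hu : u ∈ slit E M) :
    mvfderiv 𝓘(ℝ, E).tangent (fun v ↦ cubic L v (X v) (Y v) (Z v)) u (V u) =
      2 * metric L u (D (torsionT D X Y) u (V u)) (Z u) + cubic L u (X u) (Y u) (D Z u (V u)) := by
  have hT := isPiVectorField_torsionT hD.isLinearConnection hD.isRegular hX hY
  have h1 : (fun v ↦ cubic L v (X v) (Y v) (Z v)) =ᶠ[𝓝 u]
      (2 : ℝ) • fun v ↦ metric L v (torsionT D X Y v) (Z v) := by
    filter_upwards [slit_mem_nhds hu] with v hv using (metric_torsionT hL hD hX hY hZ hv).symm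
  have h2 := congrArg (fun A ↦ A (V u))
    (const_smul_mfderiv (mdifferentiableAt_metric hL hD hT hZ hu) (2 : ℝ))
  have h3 := mvfderiv_metric hD hT hZ hu (V u)
  have h4 := metric_torsionT hL hD hX hY (contMDiffOn_conn hD.isLinearConnection hZ hV) hu
  have h5 : mvfderiv 𝓘(ℝ, E).tangent (fun v ↦ cubic L v (X v) (Y v) (Z v)) u (V u) =
      2 * mvfderiv 𝓘(ℝ, E).tangent (fun v ↦ metric L v (torsionT D X Y v) (Z v)) u (V u) := by
    rw [mvfderiv, h1.mfderiv_eq]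
    exact h2
  rw [h5, h3, mul_add, h4]

theorem conn_eta_vert (hL : IsFinsler L) (hD : IsCartanConnection L D) {X : PiField E M}
    (hX : IsPiVectorField X) (hu : u ∈ slit E M) : D eta u (vert X u) = X u :=
  connMap_vert hL hD hX hu

/-- In `𝐊(βX, γY)η` the facts `D_{γY} η = Y` and `D_{βX} η = 0` leave only `-D_{βX} Y` and the
bracket term. -/
theorem connMap_mlieBracket_horiz_vert (hL : IsFinsler L) (hD : IsCartanConnection L D)
    {X Y : PiField E M} (hY : IsPiVectorField Y) (hu : u ∈ slit E M) :
    connMap D u (VectorField.mlieBracket 𝓘(ℝ, E).tangent (horiz D X) (vert Y) u) =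
      hatP D X Y u + D Y u (horiz D X u) := by
  have h1 : D (fun v ↦ D eta v (vert Y v)) u = D Y u :=
    conn_congr hD.isLinearConnection hY (fun v hv ↦ conn_eta_vert hL hD hY hv) hu
  have h2 : D (fun v ↦ D eta v (horiz D X v)) u = 0 :=
    conn_eq_zero hD.isLinearConnection (fun v _ ↦ connMap_beta v _) hu
  simp only [hatP, curvP, curvature, connMap]
  rw [h1, h2, zero_apply]
  abel

/-- The first Bianchi identity for the `hv`-curvature of the Cartan connection. -/
theorem curvP_sub_curvP (hL : IsFinsler L) (hD : IsCartanConnection L D)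
    {X Y Z : PiField E M} (hX : IsPiVectorField X) (hY : IsPiVectorField Y)
    (hZ : IsPiVectorField Z) (hu : u ∈ slit E M) :
    curvP D X Y Z u - curvP D Z Y X u =
      -D (torsionT D Y Z) u (horiz D X u) + D (torsionT D Y X) u (horiz D Z u)
      - torsionT D (fun v ↦ connMap D v
          (VectorField.mlieBracket 𝓘(ℝ, E).tangent (horiz D Z) (vert Y) v)) X u
      + torsionT D (fun v ↦ connMap D v
          (VectorField.mlieBracket 𝓘(ℝ, E).tangent (horiz D X) (vert Y) v)) Z u
      + torsionT D Y (fun v ↦ rho v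
          (VectorField.mlieBracket 𝓘(ℝ, E).tangent (horiz D X) (horiz D Z) v)) u := by
  have hlin := hD.isLinearConnection
  have ha := hX.isTVectorField_horiz hlin hD.isRegular
  have hb := hZ.isTVectorField_horiz hlin hD.isRegular
  have hv := hY.vert
  have e1 := torsion_horiz hL hD hX (hb.mlieBracket hv) hu
  have e2 := torsion_horiz hL hD hZ (ha.mlieBracket hv) hu
  have e3 := torsion_vert hL hD hY (ha.mlieBracket hb) hu
  have hX' : D (fun v ↦ rho v (horiz D X v)) u = D X u :=
    conn_congr hlin hX (fun v hv ↦ hD.isRegular.rho_beta hv _) hu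
  have hZ' : D (fun v ↦ rho v (horiz D Z v)) u = D Z u :=
    conn_congr hlin hZ (fun v hv ↦ hD.isRegular.rho_beta hv _) hu
  have hY' : D (fun v ↦ rho v (vert Y v)) u = 0 := conn_eq_zero hlin (fun v _ ↦ rho_gamma v _) hu
  -- Inner derivatives are replaced by torsion plus bracket, here and in `hQ`. The remaining double
  -- brackets cancel by the Jacobi identity `hJ`. The third cyclic curvature term is absent because
  -- `ργY = 0`.
  have hT : ∀ Z : PiField E M, IsPiVectorField Z → D (fun v ↦ D Z v (vert Y v)) u =
      D (torsionT D Y Z) u - D (fun v ↦ rho v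
        (VectorField.mlieBracket 𝓘(ℝ, E).tangent (horiz D Z) (vert Y) v)) u := by
    intro Z hZ
    have h1 := isPiVectorField_torsionT hlin hD.isRegular hY hZ
    have h2 := ((hZ.isTVectorField_horiz hlin hD.isRegular).mlieBracket hv).rho
    rw [← conn_sub hlin h1 h2 hu]
    refine conn_congr hlin (h1.sub h2) (fun w hw ↦ ?_) hu
    have h3 : torsionT D Y Z w + rho w
        (VectorField.mlieBracket 𝓘(ℝ, E).tangent (vert Y) (horiz D Z) w) = D Z w (vert Y w) := by
      rw [torsionT_apply hlin hD.isRegular hY hZ hw,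
        rho_mlieBracket_vert_horiz hlin hD.isRegular hY hZ hw, sub_add_cancel]
    rw [Pi.sub_apply, ← h3, VectorField.mlieBracket_swap_apply, map_neg, sub_eq_add_neg]
  have hQ : D (fun v ↦ rho v
      (VectorField.mlieBracket 𝓘(ℝ, E).tangent (horiz D X) (horiz D Z) v)) u =
      D (fun v ↦ D Z v (horiz D X v)) u - D (fun v ↦ D X v (horiz D Z v)) u := by
    have h1 := hX.conn_horiz hD hZ
    have h2 := hZ.conn_horiz hD hX
    rw [← conn_sub hlin h1 h2 hu]
    exact conn_congr hlin (h1.sub h2) (fun w hw ↦ rho_mlieBracket_horiz_horiz hD hX hZ hw) hu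
  have hJ : rho u (VectorField.mlieBracket 𝓘(ℝ, E).tangent (horiz D X)
        (VectorField.mlieBracket 𝓘(ℝ, E).tangent (horiz D Z) (vert Y)) u) =
      -rho u (VectorField.mlieBracket 𝓘(ℝ, E).tangent (vert Y)
        (VectorField.mlieBracket 𝓘(ℝ, E).tangent (horiz D X) (horiz D Z)) u) +
      rho u (VectorField.mlieBracket 𝓘(ℝ, E).tangent (horiz D Z)
        (VectorField.mlieBracket 𝓘(ℝ, E).tangent (horiz D X) (vert Y)) u) := by
    have h2 : minSmoothness ℝ 2 ≤ ∞ := by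
      rw [minSmoothness_of_isRCLikeNormedField]
      exact ENat.LEInfty.out
    rw [VectorField.leibniz_identity_mlieBracket_apply ((ha.contMDiffAt hu).of_le h2)
      ((hb.contMDiffAt hu).of_le h2) ((hv.contMDiffAt hu).of_le h2), map_add,
      VectorField.mlieBracket_swap_apply (V := VectorField.mlieBracket 𝓘(ℝ, E).tangent _ _),
      map_neg]
  rw [← e3, ← neg_neg (torsionT D (fun v ↦ connMap D v
    (VectorField.mlieBracket 𝓘(ℝ, E).tangent (horiz D Z) (vert Y) v)) X u), ← e1,
    ← neg_neg (torsionT D (fun v ↦ connMap D v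
    (VectorField.mlieBracket 𝓘(ℝ, E).tangent (horiz D X) (vert Y) v)) Z u), ← e2]
  simp only [torsion, curvP, curvature]
  rw [hX', hZ', hY', hT X hX, hT Z hZ, hQ, hJ]
  simp only [sub_apply, zero_apply]
  abel

/-- The covariant parts of `K[βX, γY]`, `K[βZ, γY]` and `ρ[βX, βZ]` are exactly what completes the
derivatives of `T` to covariant derivatives of `C`; only the `P̂` terms are left over. -/
theorem two_mul_metric_curvP_sub (hL : IsFinsler L) (hD : IsCartanConnection L D)
    {X Y Z W : PiField E M} (hX : IsPiVectorField X) (hY : IsPiVectorField Y)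
    (hZ : IsPiVectorField Z) (hW : IsPiVectorField W) (hu : u ∈ slit E M) :
    2 * metric L u (curvP D X Y Z u) (W u) - 2 * metric L u (curvP D Z Y X u) (W u) =
      -nablaCubic L D X Y Z W u + nablaCubic L D Z Y X W u
        - cubic L u (hatP D Z Y u) (X u) (W u) + cubic L u (hatP D X Y u) (Z u) (W u) := by
  have hlin := hD.isLinearConnection
  have ha := hX.isTVectorField_horiz hlin hD.isRegular
  have hb := hZ.isTVectorField_horiz hlin hD.isRegular
  have hP := curvP_sub_curvP hL hD hX hY hZ hu
  have h1 := metric_torsionT hL hD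
    (contMDiffOn_conn hlin isPiVectorField_eta (hb.mlieBracket hY.vert)) hX hW hu
  have h2 := metric_torsionT hL hD
    (contMDiffOn_conn hlin isPiVectorField_eta (ha.mlieBracket hY.vert)) hZ hW hu
  have h3 := metric_torsionT hL hD hY (ha.mlieBracket hb).rho hW hu
  have h1' : cubic L u (D eta u (VectorField.mlieBracket 𝓘(ℝ, E).tangent (horiz D Z) (vert Y) u))
      (X u) (W u) = cubic L u (hatP D Z Y u) (X u) (W u) +
        cubic L u (D Y u (horiz D Z u)) (X u) (W u) := by
    rw [← cubic_add_left hL hu, ← connMap_mlieBracket_horiz_vert hL hD hY hu]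
    rfl
  have h2' : cubic L u (D eta u (VectorField.mlieBracket 𝓘(ℝ, E).tangent (horiz D X) (vert Y) u))
      (Z u) (W u) = cubic L u (hatP D X Y u) (Z u) (W u) +
        cubic L u (D Y u (horiz D X u)) (Z u) (W u) := by
    rw [← cubic_add_left hL hu, ← connMap_mlieBracket_horiz_vert hL hD hY hu]
    rfl
  rw [h1'] at h1
  rw [h2'] at h2
  rw [rho_mlieBracket_horiz_horiz hD hX hZ hu, cubic_sub_middle hL hu] at h3
  have h4 := congrArg (fun A ↦ metric L u A (W u)) hP
  simp only [map_add, map_sub, map_neg, add_apply, sub_apply, neg_apply] at h4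
  simp only [nablaCubic]
  rw [mvfderiv_cubic hL hD hY hZ hW ha hu, mvfderiv_cubic hL hD hY hX hW hb hu]
  simp only [connMap] at h4
  linarith

/-- The `hv`-curvature of the Cartan connection in terms of the Cartan tensor and of the
`(v)hv`-torsion. -/
theorem two_mul_metric_curvP (hL : IsFinsler L) (hD : IsCartanConnection L D)
    {X Y Z W : PiField E M} (hX : IsPiVectorField X) (hY : IsPiVectorField Y)
    (hZ : IsPiVectorField Z) (hW : IsPiVectorField W) (hu : u ∈ slit E M) :
    2 * metric L u (curvP D X Y Z u) (W u) =
      nablaCubic L D Z Y X W u - nablaCubic L D W Y X Z u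
        - cubic L u (hatP D Z Y u) (X u) (W u) + cubic L u (hatP D W Y u) (X u) (Z u) := by
  have hs : ∀ A B C : PiField E M, IsPiVectorField A → IsPiVectorField B → IsPiVectorField C →
      metric L u (curvP D A Y B u) (C u) = -metric L u (curvP D A Y C u) (B u) := by
    intro A B C hA hB hC
    rw [metric_comm hL hu (curvP D A Y C u)]
    exact metric_curvature hL hD hB hC (hA.isTVectorField_horiz hD.isLinearConnection hD.isRegular)
      hY.vert hu
  -- Christoffel's trick: `P` is skew in its last two arguments and its skew part in the pair `X, Z`
  -- is known, so `b1 - b2 + b3` isolates four times the wanted term.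
  have b1 := two_mul_metric_curvP_sub hL hD hX hY hZ hW hu
  have b2 := two_mul_metric_curvP_sub hL hD hZ hY hW hX hu
  have b3 := two_mul_metric_curvP_sub hL hD hW hY hX hZ hu
  have s1 := hs X W Z hX hW hZ
  have s2 := hs Z X W hZ hX hW
  have s3 := hs W Z X hW hZ hX
  rw [nablaCubic_comm_right hL Z Y W X hu, cubic_comm_right hL hu _ (W u) (X u)] at b2
  rw [cubic_comm_right hL hu _ (Z u) (X u)] at b2
  rw [nablaCubic_comm_right hL W Y Z X hu] at b2
  rw [nablaCubic_comm_right hL X Y W Z hu, cubic_comm_right hL hu _ (W u) (Z u)] at b3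
  linarith

/-- With `η` in two slots every term of the formula for `P` vanishes, as `C` kills `η` and `D_{βA} η
= 0`. This removes the `P̂` term that would make `two_mul_metric_hatP` circular. -/
theorem hatP_eta (hL : IsFinsler L) (hD : IsCartanConnection L D) {Y : PiField E M}
    (hY : IsPiVectorField Y) (hu : u ∈ slit E M) : hatP D eta Y u = 0 := by
  have hη := isPiVectorField_eta (E := E) (M := M)
  have h0 : D eta u (horiz D eta u) = 0 := connMap_beta u _
  refine eq_zero_of_metric hL
    (isPiVectorField_curvP hD.isLinearConnection hD.isRegular hη hY hη) hu fun W hW ↦ ?_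
  have h := two_mul_metric_curvP hL hD hη hY hη hW hu
  have h0' : D eta u (horiz D W u) = 0 := connMap_beta u _
  rw [nablaCubic_comm_right hL eta Y eta W hu, (isCubicNull_eta hL).nablaCubic hD hη hY hW hu,
    (isCubicNull_eta hL).nablaCubic hD hW hY hη hu, h0, h0', cubic_zero, cubic_zero,
    cubic_comm_left hL hu _ (eta u) (W u), cubic_eta hL hu,
    cubic_comm_left hL hu _ (eta u) (eta u), cubic_eta hL hu] at h
  change 2 * metric L u (hatP D eta Y u) (W u) = _ at h
  linarith

theorem two_mul_metric_hatP (hL : IsFinsler L) (hD : IsCartanConnection L D)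
    {X Y W : PiField E M} (hX : IsPiVectorField X) (hY : IsPiVectorField Y)
    (hW : IsPiVectorField W) (hu : u ∈ slit E M) :
    2 * metric L u (hatP D X Y u) (W u) = nablaCubic L D eta Y X W u := by
  have hη := isPiVectorField_eta (E := E) (M := M)
  have h := two_mul_metric_curvP hL hD hX hY hη hW hu
  have h0' : D eta u (horiz D W u) = 0 := connMap_beta u _
  rw [(isCubicNull_eta hL).nablaCubic hD hW hY hX hu, h0', cubic_zero, hatP_eta hL hD hY hu,
    cubic_comm_left hL hu 0, cubic_comm_right hL hu (X u) 0, cubic_zero,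
    cubic_comm_right hL hu _ (X u), cubic_comm_left hL hu _ (eta u), cubic_eta hL hu] at h
  change 2 * metric L u (hatP D X Y u) (W u) = _ at h
  linarith

end HVCurvature

/-! ### Concircular fields. -/

section Concircular

variable {E : Type*} [NormedAddCommGroup E] [NormedSpace ℝ E]
  {M : Type*} [TopologicalSpace M] [ChartedSpace E M] [IsManifold 𝓘(ℝ, E) ∞ M]
  {L : TM E M → ℝ} {D : ConnOp E M} {u : TM E M} {σ ψ : M → ℝ} {ζ : PiField E M}

theorem contMDiffOn_comp_proj {f : M → ℝ} (hf : ContMDiff 𝓘(ℝ, E) 𝓘(ℝ, ℝ) ∞ f) :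
    ContMDiffOn 𝓘(ℝ, E).tangent 𝓘(ℝ) ∞ (fun v : TM E M ↦ f (proj E M v)) (slit E M) :=
  (hf.comp (proj E M).contMDiff).contMDiffOn

/-- The `1`-form `dψ - ψ dσ` on `TM`. -/
noncomputable def concircularForm (E : Type*) [NormedAddCommGroup E] [NormedSpace ℝ E]
    {M : Type*} [TopologicalSpace M] [ChartedSpace E M] [IsManifold 𝓘(ℝ, E) ∞ M]
    (σ ψ : M → ℝ) (V : TField E M) (u : TM E M) : ℝ :=
  mvfderiv 𝓘(ℝ, E).tangent (fun v : TM E M ↦ ψ (proj E M v)) u (V u) -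
    ψ (proj E M u) * mvfderiv 𝓘(ℝ, E).tangent (fun v : TM E M ↦ σ (proj E M v)) u (V u)

theorem contMDiffOn_concircularForm (hσ : ContMDiff 𝓘(ℝ, E) 𝓘(ℝ, ℝ) ∞ σ)
    (hψ : ContMDiff 𝓘(ℝ, E) 𝓘(ℝ, ℝ) ∞ ψ) {V : TField E M} (hV : IsTVectorField V) :
    ContMDiffOn 𝓘(ℝ, E).tangent 𝓘(ℝ) ∞ (concircularForm E σ ψ V) (slit E M) :=
  (hV.mvfderiv (contMDiffOn_comp_proj hψ)).sub
    ((contMDiffOn_comp_proj hψ).mul (hV.mvfderiv (contMDiffOn_comp_proj hσ)))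

theorem mvfderiv_comp_proj_vert {f : M → ℝ} (hf : ContMDiff 𝓘(ℝ, E) 𝓘(ℝ, ℝ) ∞ f)
    (X : PiField E M) (v : TM E M) :
    mvfderiv 𝓘(ℝ, E).tangent (fun v : TM E M ↦ f (proj E M v)) v (vert X v) = 0 :=
  (mvfderiv_comp_proj (hf.contMDiffAt.mdifferentiableAt (by simp)) _).trans
    ((congrArg (mvfderiv 𝓘(ℝ, E) f v.proj) (rho_gamma v (X v))).trans (map_zero _))

theorem hatR_eq (hD : IsCartanConnection L D) (X Y : PiField E M) (hu : u ∈ slit E M) :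
    hatR D X Y u =
      connMap D u (VectorField.mlieBracket 𝓘(ℝ, E).tangent (horiz D X) (horiz D Y) u) := by
  have h : ∀ Z : PiField E M, D (fun v ↦ D eta v (horiz D Z v)) u = 0 := fun Z ↦
    conn_eq_zero hD.isLinearConnection (fun v _ ↦ connMap_beta v _) hu
  simp only [hatR, curvR, curvature, connMap]
  rw [h, h, zero_apply, zero_apply, neg_zero, zero_add, zero_add]

/-- At a zero of `ζ` one has `D_{βA} ζ = ψA`. As `ψ ≠ 0`, the derivative of `ω` there recovers the
whole metric, which is what (f) needs at such points. -/
theorem IsConcircular.mvfderiv_metric (hD : IsCartanConnection L D) (hζ : IsConcircular D σ ψ ζ)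
    {A X : PiField E M} (hA : IsPiVectorField A) (hX : IsPiVectorField X) (hu : u ∈ slit E M)
    (h0 : ζ u = 0) :
    mvfderiv 𝓘(ℝ, E).tangent (fun v ↦ metric L v (ζ v) (X v)) u (horiz D A u) =
      ψ (proj E M u) * metric L u (A u) (X u) := by
  rw [PiFinsler.mvfderiv_metric hD hζ.isPiVectorField hX hu, hζ.horizontal A hA u hu, h0,
    smul_zero, zero_add, map_smul, map_zero, zero_apply, add_zero, smul_apply, smul_eq_mul]

theorem mvfderiv_mul_apply_of_eq_zero {f g : TM E M → ℝ}
    (hf : MDifferentiableAt 𝓘(ℝ, E).tangent 𝓘(ℝ) f u)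
    (hg : MDifferentiableAt 𝓘(ℝ, E).tangent 𝓘(ℝ) g u) (h0 : g u = 0)
    (V : TangentSpace 𝓘(ℝ, E).tangent u) :
    mvfderiv 𝓘(ℝ, E).tangent (fun v ↦ f v * g v) u V =
      f u * mvfderiv 𝓘(ℝ, E).tangent g u V := by
  have h := congrArg (fun A ↦ A V) (mvfderiv_mul hf hg)
  rw [h0, zero_smul, add_zero] at h
  exact h

variable [FiniteDimensional ℝ E]

theorem hDiff_rho (hR : IsRegular D) {f : M → ℝ} (hf : ContMDiff 𝓘(ℝ, E) 𝓘(ℝ, ℝ) ∞ f)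
    (hu : u ∈ slit E M) (V : TangentSpace 𝓘(ℝ, E).tangent u) :
    hDiff D f u (rho u V) =
      mvfderiv 𝓘(ℝ, E).tangent (fun v : TM E M ↦ f (proj E M v)) u V :=
  (mvfderiv_comp_proj (hf.contMDiffAt.mdifferentiableAt (by simp)) _).trans
    ((congrArg (mvfderiv 𝓘(ℝ, E) f u.proj) (hR.rho_beta hu (rho u V))).trans
      (mvfderiv_comp_proj (hf.contMDiffAt.mdifferentiableAt (by simp)) _).symm)

variable [CompleteSpace E]

/-- The two concircular equations merge into one by the splitting `V = βρV + γKV`, because `dσ`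
vanishes on vertical vectors. -/
theorem IsConcircular.conn (hL : IsFinsler L) (hD : IsCartanConnection L D)
    (hζ : IsConcircular D σ ψ ζ) {V : TField E M} (hV : IsTVectorField V) (hu : u ∈ slit E M) :
    D ζ u (V u) =
      mvfderiv 𝓘(ℝ, E).tangent (fun v : TM E M ↦ σ (proj E M v)) u (V u) • ζ u +
        ψ (proj E M u) • rho u (V u) := by
  have h1 := congrArg (D ζ u) (eq_horiz_add_vert hL hD hV hu)
  have hK : IsPiVectorField fun v ↦ connMap D v (V v) :=
    contMDiffOn_conn hD.isLinearConnection isPiVectorField_eta hV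
  rw [Pi.add_apply, map_add, hζ.horizontal _ hV.rho u hu, hζ.vertical _ hK u hu, add_zero,
    hDiff_rho hD.isRegular hζ.smooth_sigma hu] at h1
  exact h1

theorem IsConcircular.conn_conn (hL : IsFinsler L) (hD : IsCartanConnection L D)
    (hζ : IsConcircular D σ ψ ζ) {V W : TField E M} (hV : IsTVectorField V)
    (hW : IsTVectorField W) (hu : u ∈ slit E M) :
    D (fun v ↦ D ζ v (W v)) u (V u) =
      mvfderiv 𝓘(ℝ, E).tangent (fun v : TM E M ↦ σ (proj E M v)) u (W u) •
        (mvfderiv 𝓘(ℝ, E).tangent (fun v : TM E M ↦ σ (proj E M v)) u (V u) • ζ u +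
          ψ (proj E M u) • rho u (V u)) +
      mvfderiv 𝓘(ℝ, E).tangent (fun v ↦ mvfderiv 𝓘(ℝ, E).tangent
        (fun v : TM E M ↦ σ (proj E M v)) v (W v)) u (V u) • ζ u +
      (ψ (proj E M u) • D (fun v ↦ rho v (W v)) u (V u) +
      mvfderiv 𝓘(ℝ, E).tangent (fun v : TM E M ↦ ψ (proj E M v)) u (V u) • rho u (W u)) := by
  have hlin := hD.isLinearConnection
  have hσ := hW.mvfderiv (contMDiffOn_comp_proj hζ.smooth_sigma)
  have hψ := contMDiffOn_comp_proj hζ.smooth_psi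
  have h1 := hζ.isPiVectorField.smul hσ
  have h2 := hW.rho.smul hψ
  have h3 := conn_congr hlin (h1.add h2) (fun v hv ↦ hζ.conn hL hD hW hv) hu
  rw [h3, conn_add hlin h1 h2 hu, add_apply, conn_smul hlin hσ hζ.isPiVectorField hu,
    conn_smul hlin hψ hW.rho hu, hζ.conn hL hD hV hu]

/-- The curvature applied to a concircular `π`-vector field. -/
theorem IsConcircular.curvature_eq (hL : IsFinsler L) (hD : IsCartanConnection L D)
    (hζ : IsConcircular D σ ψ ζ) {V W : TField E M} (hV : IsTVectorField V)
    (hW : IsTVectorField W) (hu : u ∈ slit E M) :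
    curvature D V W ζ u = concircularForm E σ ψ W u • rho u (V u) -
      concircularForm E σ ψ V u • rho u (W u) - ψ (proj E M u) • torsion D V W u := by
  have h1 := mvfderiv_mlieBracket (((contMDiffOn_comp_proj hζ.smooth_sigma).contMDiffAt
    (slit_mem_nhds hu)).of_le ENat.LEInfty.out) (hV.mdifferentiableAt hu) (hW.mdifferentiableAt hu)
  simp only [curvature, torsion, concircularForm]
  rw [hζ.conn_conn hL hD hV hW hu, hζ.conn_conn hL hD hW hV hu,
    hζ.conn hL hD (hV.mlieBracket hW) hu, h1]
  module

/-- This is `g(𝐊(V, W)ζ, ζ) = 0`, the common source of `IsConcircular.isCubicNull` (one vertical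
field) and of (e) (two horizontal fields). -/
theorem IsConcircular.metric_curvature (hL : IsFinsler L) (hD : IsCartanConnection L D)
    (hζ : IsConcircular D σ ψ ζ) {V W : TField E M} (hV : IsTVectorField V)
    (hW : IsTVectorField W) (hu : u ∈ slit E M) :
    concircularForm E σ ψ W u * metric L u (rho u (V u)) (ζ u) -
      concircularForm E σ ψ V u * metric L u (rho u (W u)) (ζ u) -
      ψ (proj E M u) * metric L u (torsion D V W u) (ζ u) = 0 := by
  have h1 := PiFinsler.metric_curvature hL hD hζ.isPiVectorField hζ.isPiVectorField hV hW hu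
  rw [metric_comm hL hu (ζ u), hζ.curvature_eq hL hD hV hW hu] at h1
  simp only [map_sub, map_smul, sub_apply, smul_apply, smul_eq_mul] at h1
  linarith

theorem IsConcircular.isCubicNull (hL : IsFinsler L) (hD : IsCartanConnection L D)
    (hζ : IsConcircular D σ ψ ζ) : IsCubicNull L ζ := by
  intro X Y hX hY u hu
  have h := hζ.metric_curvature hL hD hX.vert
    (hY.isTVectorField_horiz hD.isLinearConnection hD.isRegular) hu
  have h1 : rho u (vert X u) = 0 := rho_gamma u _
  have h2 : concircularForm E σ ψ (vert X) u = 0 := by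
    rw [concircularForm, mvfderiv_comp_proj_vert hζ.smooth_sigma,
      mvfderiv_comp_proj_vert hζ.smooth_psi]
    ring
  have h3 : metric L u (torsionT D X Y u) (ζ u) = 0 := by
    rw [h1, h2, map_zero, zero_apply] at h
    have h4 : ψ (proj E M u) * metric L u (torsionT D X Y u) (ζ u) = 0 := by
      change _ - _ - ψ (proj E M u) * metric L u (torsionT D X Y u) (ζ u) = 0 at h
      linarith
    exact (mul_eq_zero.1 h4).resolve_left (hζ.psi_ne_zero _)
  rw [← metric_torsionT hL hD hX hY hζ.isPiVectorField hu, h3, mul_zero]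

theorem IsConcircular.concircularForm_mul_metric (hL : IsFinsler L) (hD : IsCartanConnection L D)
    (hζ : IsConcircular D σ ψ ζ) {X Y : PiField E M} (hX : IsPiVectorField X)
    (hY : IsPiVectorField Y) (hu : u ∈ slit E M) :
    concircularForm E σ ψ (horiz D Y) u * metric L u (ζ u) (X u) =
      concircularForm E σ ψ (horiz D X) u * metric L u (ζ u) (Y u) := by
  have h := hζ.metric_curvature hL hD
    (hX.isTVectorField_horiz hD.isLinearConnection hD.isRegular)
    (hY.isTVectorField_horiz hD.isLinearConnection hD.isRegular) hu
  have h1 : rho u (horiz D X u) = X u := hD.isRegular.rho_beta hu _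
  have h2 : rho u (horiz D Y u) = Y u := hD.isRegular.rho_beta hu _
  have h3 : torsion D (horiz D X) (horiz D Y) u = 0 := hD.torsionQ_eq_zero X Y hX hY u hu
  rw [h1, h2, h3, map_zero, zero_apply, metric_comm hL hu (X u), metric_comm hL hu (Y u)] at h
  linarith

theorem IsCubicNull.torsionT_right (hL : IsFinsler L) (hD : IsCartanConnection L D)
    (hζ : IsPiVectorField ζ) (h : IsCubicNull L ζ) {X : PiField E M} (hX : IsPiVectorField X)
    (hu : u ∈ slit E M) : torsionT D X ζ u = 0 := by
  refine eq_zero_of_metric hL (isPiVectorField_torsionT hD.isLinearConnection hD.isRegular hX hζ)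
    hu fun W hW ↦ ?_
  have h1 := metric_torsionT hL hD hX hζ hW hu
  rw [cubic_comm_right hL hu, h X W hX hW u hu] at h1
  linarith

theorem IsCubicNull.torsionT_left (hL : IsFinsler L) (hD : IsCartanConnection L D)
    (hζ : IsPiVectorField ζ) (h : IsCubicNull L ζ) {X : PiField E M} (hX : IsPiVectorField X)
    (hu : u ∈ slit E M) : torsionT D ζ X u = 0 := by
  refine eq_zero_of_metric hL (isPiVectorField_torsionT hD.isLinearConnection hD.isRegular hζ hX)
    hu fun W hW ↦ ?_
  have h1 := metric_torsionT hL hD hζ hX hW hu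
  rw [cubic_comm_left hL hu, cubic_comm_right hL hu, h X W hX hW u hu] at h1
  linarith

/-- Only the part `ψA` of `D_{βA} ζ` contributes, its part along `ζ` being killed by `C`. The result
is symmetric in `A`, `X`, `Y`, which makes the derivative terms of `P` cancel. -/
theorem IsConcircular.nablaCubic (hL : IsFinsler L) (hD : IsCartanConnection L D)
    (hζ : IsConcircular D σ ψ ζ) {A X Y : PiField E M} (hA : IsPiVectorField A)
    (hX : IsPiVectorField X) (hY : IsPiVectorField Y) (hu : u ∈ slit E M) :
    nablaCubic L D A X Y ζ u = -(ψ (proj E M u) * cubic L u (X u) (Y u) (A u)) := by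
  have h := hζ.isCubicNull hL hD
  rw [h.nablaCubic hD hA hX hY hu, hζ.horizontal A hA u hu, cubic_add, cubic_smul, cubic_smul,
    h X Y hX hY u hu, mul_zero, zero_add]

theorem IsConcircular.hatP_right (hL : IsFinsler L) (hD : IsCartanConnection L D)
    (hζ : IsConcircular D σ ψ ζ) {X : PiField E M} (hX : IsPiVectorField X) (hu : u ∈ slit E M) :
    hatP D X ζ u = 0 := by
  refine eq_zero_of_metric hL (isPiVectorField_curvP hD.isLinearConnection hD.isRegular hX
    hζ.isPiVectorField isPiVectorField_eta) hu fun W hW ↦ ?_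
  have h := two_mul_metric_hatP hL hD hX hζ.isPiVectorField hW hu
  rw [nablaCubic_comm_left hL _ _ _ _ hu, nablaCubic_comm_right hL _ _ _ _ hu,
    hζ.nablaCubic hL hD isPiVectorField_eta hX hW hu,
    isCubicNull_eta hL X W hX hW u hu] at h
  change 2 * metric L u (hatP D X ζ u) (W u) = _ at h
  linarith

theorem IsConcircular.hatP_left (hL : IsFinsler L) (hD : IsCartanConnection L D)
    (hζ : IsConcircular D σ ψ ζ) {X : PiField E M} (hX : IsPiVectorField X) (hu : u ∈ slit E M) :
    hatP D ζ X u = 0 := by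
  refine eq_zero_of_metric hL (isPiVectorField_curvP hD.isLinearConnection hD.isRegular
    hζ.isPiVectorField hX isPiVectorField_eta) hu fun W hW ↦ ?_
  have h := two_mul_metric_hatP hL hD hζ.isPiVectorField hX hW hu
  rw [nablaCubic_comm_right hL _ _ _ _ hu, hζ.nablaCubic hL hD isPiVectorField_eta hX hW hu,
    isCubicNull_eta hL X W hX hW u hu] at h
  linarith

/-- Both derivative terms equal `-ψ C(X, Y, W)` and cancel; the other two contain `P̂(·, ζ) = 0`. -/
theorem IsConcircular.curvP_middle (hL : IsFinsler L) (hD : IsCartanConnection L D)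
    (hζ : IsConcircular D σ ψ ζ) {X Y : PiField E M} (hX : IsPiVectorField X)
    (hY : IsPiVectorField Y) (hu : u ∈ slit E M) : curvP D X ζ Y u = 0 := by
  refine eq_zero_of_metric hL (isPiVectorField_curvP hD.isLinearConnection hD.isRegular hX
    hζ.isPiVectorField hY) hu fun W hW ↦ ?_
  have h := two_mul_metric_curvP hL hD hX hζ.isPiVectorField hY hW hu
  rw [nablaCubic_comm_left hL _ _ _ _ hu, nablaCubic_comm_right hL _ _ _ _ hu,
    hζ.nablaCubic hL hD hY hX hW hu,
    nablaCubic_comm_left hL _ _ _ _ hu, nablaCubic_comm_right hL _ _ _ _ hu,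
    hζ.nablaCubic hL hD hW hX hY hu, hζ.hatP_right hL hD hY hu, hζ.hatP_right hL hD hW hu,
    cubic_comm_left hL hu 0, cubic_comm_right hL hu _ 0, cubic_zero,
    cubic_comm_left hL hu 0, cubic_comm_right hL hu _ 0, cubic_zero,
    cubic_comm_right hL hu (X u) (Y u)] at h
  linarith

/-- The derivative terms cancel as for `curvP_middle`; here the `P̂` terms vanish because `ζ` is an
argument of `C`. -/
theorem IsConcircular.curvP_left (hL : IsFinsler L) (hD : IsCartanConnection L D)
    (hζ : IsConcircular D σ ψ ζ) {X Y : PiField E M} (hX : IsPiVectorField X)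
    (hY : IsPiVectorField Y) (hu : u ∈ slit E M) : curvP D ζ X Y u = 0 := by
  refine eq_zero_of_metric hL (isPiVectorField_curvP hD.isLinearConnection hD.isRegular
    hζ.isPiVectorField hX hY) hu fun W hW ↦ ?_
  have hn := hζ.isCubicNull hL hD
  have hP : ∀ Z : PiField E M, IsPiVectorField Z → IsPiVectorField (hatP D Z X) := fun Z hZ ↦
    isPiVectorField_curvP hD.isLinearConnection hD.isRegular hZ hX isPiVectorField_eta
  have h := two_mul_metric_curvP hL hD hζ.isPiVectorField hX hY hW hu
  rw [nablaCubic_comm_right hL _ X ζ W hu, hζ.nablaCubic hL hD hY hX hW hu,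
    nablaCubic_comm_right hL _ X ζ Y hu, hζ.nablaCubic hL hD hW hX hY hu,
    cubic_comm_right hL hu _ (ζ u) (W u), hn _ _ (hP Y hY) hW u hu,
    cubic_comm_right hL hu _ (ζ u) (Y u), hn _ _ (hP W hW) hY u hu,
    cubic_comm_right hL hu (X u) (Y u)] at h
  linarith

theorem IsConcircular.concircularForm_torsionT (hL : IsFinsler L) (hD : IsCartanConnection L D)
    (hζ : IsConcircular D σ ψ ζ) {X Y : PiField E M} (hX : IsPiVectorField X)
    (hY : IsPiVectorField Y) (hu : u ∈ slit E M) :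
    concircularForm E σ ψ (horiz D (torsionT D X Y)) u = 0 := by
  have hlin := hD.isLinearConnection
  have hT := isPiVectorField_torsionT hlin hD.isRegular hX hY
  have hη := isPiVectorField_eta (E := E) (M := M)
  have hnull : ∀ Z : PiField E M, IsPiVectorField Z → IsCubicNull L Z →
      metric L u (Z u) (torsionT D X Y u) = 0 := by
    intro Z hZ hn
    have h := metric_torsionT hL hD hX hY hZ hu
    rw [hn X Y hX hY u hu, metric_comm hL hu] at h
    linarith
  -- At a zero of `ζ` both sides of (e) vanish, so (e) for `η` and `T(X, Y)` is differentiated along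
  -- `βη`; it holds on a neighbourhood of `u`.
  by_cases h0 : ζ u = 0
  · have hf : ∀ Z : PiField E M, IsPiVectorField Z →
        MDifferentiableAt 𝓘(ℝ, E).tangent 𝓘(ℝ) (concircularForm E σ ψ (horiz D Z)) u :=
      fun Z hZ ↦ ((contMDiffOn_concircularForm hζ.smooth_sigma hζ.smooth_psi
        (hZ.isTVectorField_horiz hlin hD.isRegular)).contMDiffAt
          (slit_mem_nhds hu)).mdifferentiableAt (by simp)
    have hg : ∀ Z : PiField E M, metric L u (ζ u) (Z u) = 0 := fun Z ↦ by
      rw [h0, map_zero, zero_apply]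
    have he : (fun v ↦ concircularForm E σ ψ (horiz D (torsionT D X Y)) v *
          metric L v (ζ v) (eta v)) =ᶠ[𝓝 u]
        fun v ↦ concircularForm E σ ψ (horiz D eta) v * metric L v (ζ v) (torsionT D X Y v) := by
      filter_upwards [slit_mem_nhds hu] with v hv using
        hζ.concircularForm_mul_metric hL hD hη hT hv
    have h1 := mvfderiv_mul_apply_of_eq_zero (hf _ hT)
      (mdifferentiableAt_metric hL hD hζ.isPiVectorField hη hu) (hg eta) (horiz D eta u)
    have h2 := mvfderiv_mul_apply_of_eq_zero (hf _ hη)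
      (mdifferentiableAt_metric hL hD hζ.isPiVectorField hT hu) (hg _) (horiz D eta u)
    rw [hζ.mvfderiv_metric hD hη hη hu h0] at h1
    rw [hζ.mvfderiv_metric hD hη hT hu h0, hnull eta hη (isCubicNull_eta hL), mul_zero,
      mul_zero] at h2
    have h3 : mvfderiv 𝓘(ℝ, E).tangent (fun v ↦
        concircularForm E σ ψ (horiz D (torsionT D X Y)) v * metric L v (ζ v) (eta v)) u
          (horiz D eta u) = 0 := by
      rw [mvfderiv, he.mfderiv_eq]
      exact h2
    have h4 : metric L u (eta u) (eta u) ≠ 0 := (hL.posDef u hu _ hu).ne'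
    rw [h1] at h3
    exact (mul_eq_zero.1 h3).resolve_right (mul_ne_zero (hζ.psi_ne_zero _) h4)
  · have h := hζ.concircularForm_mul_metric hL hD hζ.isPiVectorField hT hu
    rw [hnull ζ hζ.isPiVectorField (hζ.isCubicNull hL hD), mul_zero] at h
    exact (mul_eq_zero.1 h).resolve_right (hL.posDef u hu _ h0).ne'

end Concircular
end PiFinsler

theorem proposition2
    {E : Type*} [NormedAddCommGroup E] [NormedSpace ℝ E] [FiniteDimensional ℝ E]
    {M : Type*} [TopologicalSpace M] [T2Space M] [SecondCountableTopology M]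
    [ChartedSpace E M] [IsManifold 𝓘(ℝ, E) ∞ M]
    (L : PiFinsler.TM E M → ℝ) (hL : PiFinsler.IsFinsler L)
    (D : PiFinsler.ConnOp E M) (hD : PiFinsler.IsCartanConnection L D)
    (σ ψ : M → ℝ) (ζ : PiFinsler.PiField E M) (hζ : PiFinsler.IsConcircular D σ ψ ζ)
    (X Y : PiFinsler.PiField E M)
    (hX : PiFinsler.IsPiVectorField X) (hY : PiFinsler.IsPiVectorField Y)
    (u : PiFinsler.TM E M) (hu : u ∈ PiFinsler.slit E M) :
    (PiFinsler.torsionT D X ζ u = 0 ∧ PiFinsler.torsionT D ζ X u = 0) ∧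
    (PiFinsler.hatP D X ζ u = 0 ∧ PiFinsler.hatP D ζ X u = 0) ∧
    PiFinsler.hatR D X ζ u =
      PiFinsler.connMap D u (VectorField.mlieBracket 𝓘(ℝ, E).tangent
        (PiFinsler.horiz D X) (PiFinsler.horiz D ζ) u) ∧
    (PiFinsler.curvP D X ζ Y u = 0 ∧ PiFinsler.curvP D ζ X Y u = 0) ∧
    (PiFinsler.hDiff D ψ u (Y u) - ψ (PiFinsler.proj E M u) * PiFinsler.hDiff D σ u (Y u))
        * PiFinsler.metric L u (ζ u) (X u)
      - (PiFinsler.hDiff D ψ u (X u) - ψ (PiFinsler.proj E M u) * PiFinsler.hDiff D σ u (X u))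
        * PiFinsler.metric L u (ζ u) (Y u) = 0 ∧
    PiFinsler.hDiff D ψ u (PiFinsler.torsionT D X Y u) =
      ψ (PiFinsler.proj E M u) * PiFinsler.hDiff D σ u (PiFinsler.torsionT D X Y u) := by
  have := FiniteDimensional.complete ℝ E
  have hn := hζ.isCubicNull hL hD
  exact ⟨⟨hn.torsionT_right hL hD hζ.isPiVectorField hX hu,
      hn.torsionT_left hL hD hζ.isPiVectorField hX hu⟩,
    ⟨hζ.hatP_right hL hD hX hu, hζ.hatP_left hL hD hX hu⟩,
    PiFinsler.hatR_eq hD X ζ hu,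
    ⟨hζ.curvP_middle hL hD hX hY hu, hζ.curvP_left hL hD hX hY hu⟩,
    -- On `βX` the form `θ` unfolds by definition to `μ(X) - ψ α(X)`.
    sub_eq_zero.2 (hζ.concircularForm_mul_metric hL hD hX hY hu),
    sub_eq_zero.1 (hζ.concircularForm_torsionT hL hD hX hY hu)⟩
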